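/- Let $k$ be a commutative ring, $R$ an associative unital $k$-algebra, $Q$ a finite quasigroup with at least two elements (for all $b,c$ there is a unique $a$ with $ab=c$; for all $a,c$ there is a unique $b=:a\backslash c$ with $ab=c$), $p:Q\to M$ a bijection onto a set $M$, and $\mu:M^3\to M$ a map such that, for all $a,b,c,d\in M$, $$\mu(a,\mu(a,b,c),\mu(\mu(a,b,c),c,d))=\mu(a,b,\mu(b,c,d)),$$ $$\mu(\mu(a,b,c),c,d)=\mu(\mu(a,b,\mu(b,c,d)),\mu(b,c,d),d),$$ and such that $\mu(a,b,c)=d$ has a unique solution in each of $a$, $b$, $c$ when the other three elements are given. Let $L$ be the $k$-algebra of all maps $Q\to R$ with pointwise operations. For $a,b,c,d\in Q$ define $\sigma^{ab}_{cd}\in L$ by $\sigma^{ab}_{cd}(\lambda)=1$ if $c=m\backslash((\lambda b)a)$ and $d=\lambda\backslash m$, where $m=p^{-1}(\mu(p(\lambda),p(\lambda b),p((\lambda b)a)))$, and $\sigma^{ab}_{cd}(\lambda)=0$ otherwise. For $a\in Q$ let $T_a:L\to L$ be the automorphism $(T_af)(\lambda)=f(\lambda a)$. Let $A_\sigma$ be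 the $k$-algebra generated by the elements of $L\otimes_kL^{op}$ and by indeterminates $L_{ab}$, $(L^{-1})_{ab}$ $(a,b\in Q)$, subject to the following relations, for all $a,b,c,d\in Q$ and $f\in L$: sums, scalar multiples, products and the unit of $L\otimes_kL^{op}$ agree with those of $A_\sigma$; $\sum_cL_{ac}(L^{-1})_{cb}=\delta_{ab}=\sum_c(L^{-1})_{ac}L_{cb}$; $$(T_a(f)\otimes1)L_{ab}=L_{ab}(f\otimes1),\qquad(1\otimes T_b(f))L_{ab}=L_{ab}(1\otimes f),$$ $$(f\otimes1)(L^{-1})_{ab}=(L^{-1})_{ab}(T_b(f)\otimes1),\qquad(1\otimes f)(L^{-1})_{ab}=(L^{-1})_{ab}(1\otimes T_a(f));$$ $$\sum_{x,y}(\sigma^{xy}_{ac}\otimes1)L_{yd}L_{xb}=\sum_{x,y}(1\otimes\sigma^{bd}_{xy})L_{cy}L_{ax}.$$ Definitions. A left bialgebroid $(A,L,s,t,\Delta,\pi)$ consists of $k$-algebras $A,L$, homomorphisms $s:L\to A$, $t:L^{op}\to A$ with commuting images, and a comonoid structure $\Delta:A\to A\otimes_LA$, $\pi:A\to L$ on the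 $L$-bimodule $A$, $l\cdot a\cdot l'=s(l)t(l')a$, such that, with $\Delta(a)=a_{(1)}\otimes a_{(2)}$: $a_{(1)}t(l)\otimes a_{(2)}=a_{(1)}\otimes a_{(2)}s(l)$, $\Delta(1)=1\otimes1$, $\Delta(ab)=\Delta(a)\Delta(b)$, $\pi(1)=1$, $\pi(a\,s(\pi(b)))=\pi(ab)=\pi(a\,t(\pi(b)))$. It is, together with an anti-automorphism $S$ of $A$, a Hopf algebroid if $S\circ t=s$; $S(a_{(1)})a_{(2)}=t(\pi(S(a)))$; $(\Delta\otimes\mathrm{id})\Delta'=(\mathrm{id}\otimes\Delta')\Delta$ and $(\Delta'\otimes\mathrm{id})\Delta=(\mathrm{id}\otimes\Delta)\Delta'$; the map $\theta':A\otimes_{L'}A\to A\otimes_LA$, $a\otimes b\mapsto S(b)\otimes S(a)$, is bijective; and $\Delta'=\theta'^{-1}\circ\Delta\circ S$. Here $L'=L^{op}$, $A\otimes_{L'}A$ is $A\otimes_kA$ modulo $a\,S(s(l))\otimes b=a\otimes b\,s(l)$, and $\Delta'=\theta\circ\Delta\circ S^{-1}$ with $\theta:A\otimes_LA\to A\otimes_{L'}A$,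 $a\otimes b\mapsto S(b)\otimes S(a)$. A left bialgebroid $(A,L,s,t,\Delta,\pi)$ *is a weak Hopf algebra* if it is the bialgebroid underlying one, that is, if the $k$-algebra $A$ has a weak Hopf algebra structure over $k$, with comultiplication $\Delta_w$, $\Delta_w(1)=1_{(1)}\otimes1_{(2)}$, and counit $\varepsilon$, such that $s(\pi(a))=\varepsilon(1_{(1)}a)1_{(2)}$, $t(l)=1_{(1)}\varepsilon(1_{(2)}s(l))$, and $\Delta(a)$ is the image of $\Delta_w(a)$ in $A\otimes_LA$, for all $a\in A$, $l\in L$. A $k$-algebra $B$ is *separable with an idempotent Frobenius system* if there are a $k$-linear $\phi:B\to k$ and $e=\sum e^{(1)}\otimes e^{(2)}\in B\otimes_kB$ with $b=\sum\phi(be^{(1)})e^{(2)}=\sum e^{(1)}\phi(e^{(2)}b)$ for all $b\in B$ and $\sum e^{(1)}e^{(2)}=1$. **Statement.** $L\cong R^{|Q|}$ as $k$-algebras, and $A_\sigma$ is a Hopf algebroid over $L$, with $k$-linear structure maps satisfying $$s(l)=l\otimes1,\quad t(l)=1\otimes l,\quad\Delta(L_{ab})=\sum_cL_{ac}\otimes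 L_{cb},\quad\Delta((L^{-1})_{ab})=\sum_c(L^{-1})_{cb}\otimes(L^{-1})_{ac},$$ $$\pi(L_{ab})=\pi((L^{-1})_{ab})=\delta_{ab},\quad S(l\otimes1)=1\otimes l,\quad S(1\otimes l)=l\otimes1,\quad S(L_{ab})=(L^{-1})_{ab}.$$ Moreover, if $R$ is not separable with an idempotent Frobenius system, then neither is $L$, and the left bialgebroid $A_\sigma$ is not a weak Hopf algebra. -/

import Mathlib

open scoped TensorProduct
open MulOpposite

namespace HopfAlgd

noncomputable section

/-! ### Tensor products over noncommutative rings

For `k`-modules carrying actions of a `k`-algebra `L`, a tensor product over `L` is the quotient of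
the tensor product over `k` by the balancing relations. -/

/-- The `k`-submodule of `M ⊗ N` spanned by all `r(l) m ⊗ n - m ⊗ g(l) n`, where `r` is a right
action on `M` and `g` is a left action on `N`. The quotient by it is `M ⊗_L N`. -/
def balanced (k : Type*) {ι M N : Type*} [CommRing k] [AddCommGroup M] [Module k M]
    [AddCommGroup N] [Module k N] (r : ι → M → M) (g : ι → N → N) : Submodule k (M ⊗[k] N) :=
  Submodule.span k {z | ∃ (l : ι) (m : M) (n : N), z = r l m ⊗ₜ[k] n - m ⊗ₜ[k] g l n}

section Triple

variable {k A : Type*} [CommRing k] [Ring A] [Algebra k A]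

/-- The relations in `A ⊗ (A ⊗ A)` given by `P` in the first two factors and by `Q` in the last
two. -/
def tripleRel (P Q : Submodule k (A ⊗[k] A)) : Submodule k (A ⊗[k] (A ⊗[k] A)) :=
  (LinearMap.range (P.subtype.rTensor A)).map
      (TensorProduct.assoc k A A A).toLinearMap ⊔
    LinearMap.range (Q.subtype.lTensor A)

/-- The triple tensor product whose first tensor sign is balanced by `P`, the second by `Q`. -/
abbrev Triple (P Q : Submodule k (A ⊗[k] A)) : Type _ :=
  (A ⊗[k] (A ⊗[k] A)) ⧸ tripleRel P Q

/-- The canonical map `(A ⊗ A / P) ⊗ A → Triple P Q`. -/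
def tripleLeft (P Q : Submodule k (A ⊗[k] A)) :
    ((A ⊗[k] A) ⧸ P) ⊗[k] A →ₗ[k] Triple P Q :=
  TensorProduct.lift <| P.liftQ
    (TensorProduct.curry ((tripleRel P Q).mkQ ∘ₗ (TensorProduct.assoc k A A A).toLinearMap)) <| by
      intro x hx
      rw [LinearMap.mem_ker]
      ext a
      simp only [TensorProduct.curry_apply, LinearMap.comp_apply, LinearMap.zero_apply,
        Submodule.mkQ_apply, Submodule.Quotient.mk_eq_zero]
      exact Submodule.mem_sup_left ⟨_, ⟨(⟨x, hx⟩ : P) ⊗ₜ[k] a, rfl⟩, rfl⟩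

/-- The canonical map `A ⊗ (A ⊗ A / Q) → Triple P Q`. -/
def tripleRight (P Q : Submodule k (A ⊗[k] A)) :
    A ⊗[k] ((A ⊗[k] A) ⧸ Q) →ₗ[k] Triple P Q :=
  TensorProduct.lift <| LinearMap.flip <| Q.liftQ
    (TensorProduct.curry (tripleRel P Q).mkQ).flip <| by
      intro x hx
      rw [LinearMap.mem_ker]
      ext a
      simp only [TensorProduct.curry_apply, LinearMap.flip_apply, LinearMap.zero_apply,
        Submodule.mkQ_apply, Submodule.Quotient.mk_eq_zero]
      exact Submodule.mem_sup_right ⟨a ⊗ₜ[k] (⟨x, hx⟩ : Q), rfl⟩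

end Triple

/-! ### Left bialgebroids and Hopf algebroids -/

section Algebroid

variable {k A L : Type*} [CommRing k] [Ring A] [Algebra k A] [Ring L] [Algebra k L]

/-- The relations `t(l) a ⊗ b = a ⊗ s(l) b` that define `A ⊗_L A`. -/
def leftRel (s : L →ₐ[k] A) (t : Lᵐᵒᵖ →ₐ[k] A) : Submodule k (A ⊗[k] A) :=
  balanced k (fun (l : L) (a : A) => t (op l) * a) (fun (l : L) (b : A) => s l * b)

/-- The relations `a S(s(l)) ⊗ b = a ⊗ b s(l)` that define `A ⊗_{L'} A` for `L' = Lᵒᵖ`. -/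
def rightRel (s : L →ₐ[k] A) (S : A ≃ₐ[k] Aᵐᵒᵖ) : Submodule k (A ⊗[k] A) :=
  balanced k (fun (l : L) (a : A) => a * (S (s l)).unop) (fun (l : L) (b : A) => b * s l)

variable (k A L) in
/-- A left bialgebroid over `L`, for `k`-algebras `A` and `L` (rings, if `k = ℤ`). Sweedler's
notation `Δ(a) = a₁ ⊗ a₂` is rendered by quantifying over all representatives `x` in `A ⊗[k] A` of
the element `Δ(a)` of `A ⊗_L A`. -/
structure LeftBialgebroid where
  s : L →ₐ[k] A
  t : Lᵐᵒᵖ →ₐ[k] A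
  s_mul_t : ∀ l l', s l * t l' = t l' * s l
  /-- `Δ : A → A ⊗_L A` -/
  comul : A →ₗ[k] (A ⊗[k] A) ⧸ leftRel s t
  /-- `π : A → L` -/
  counit : A →ₗ[k] L
  -- `Δ` and `π` are maps of `L`-bimodules, where `l · a · l' = s(l) t(l') a`
  comul_bimod : ∀ l l' a x, (leftRel s t).mkQ x = comul a →
    comul (s l * t (op l') * a) = (leftRel s t).mkQ ((s l ⊗ₜ[k] t (op l')) * x)
  counit_bimod : ∀ l l' a, counit (s l * t (op l') * a) = l * counit a * l'
  -- coassociativity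
  coassoc : ∀ a x, (leftRel s t).mkQ x = comul a →
    tripleLeft (leftRel s t) (leftRel s t) (comul.rTensor A x) =
      tripleRight (leftRel s t) (leftRel s t) (comul.lTensor A x)
  -- counit laws: `s(π(a₁)) a₂ = a` and `t(π(a₂)) a₁ = a`
  counit_comul : ∀ a x, (leftRel s t).mkQ x = comul a →
    LinearMap.mul' k A (TensorProduct.map (s.toLinearMap ∘ₗ counit) LinearMap.id x) = a
  comul_counit : ∀ a x, (leftRel s t).mkQ x = comul a →
    LinearMap.mul' k A (TensorProduct.comm k A A (TensorProduct.map LinearMap.id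
      (t.toLinearMap ∘ₗ (opLinearEquiv k).toLinearMap ∘ₗ counit) x)) = a
  -- `a₁ t(l) ⊗ a₂ = a₁ ⊗ a₂ s(l)`
  comul_takeuchi : ∀ l a x, (leftRel s t).mkQ x = comul a →
    (leftRel s t).mkQ (x * (t (op l) ⊗ₜ[k] 1)) = (leftRel s t).mkQ (x * (1 ⊗ₜ[k] s l))
  comul_one : comul 1 = (leftRel s t).mkQ (1 ⊗ₜ[k] 1)
  comul_mul : ∀ a b x y, (leftRel s t).mkQ x = comul a → (leftRel s t).mkQ y = comul b →
    comul (a * b) = (leftRel s t).mkQ (x * y)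
  counit_one : counit 1 = 1
  counit_mul_s : ∀ a b, counit (a * s (counit b)) = counit (a * b)
  counit_mul_t : ∀ a b, counit (a * t (op (counit b))) = counit (a * b)

variable (k A L) in
/-- A left bialgebroid with an anti-automorphism `S` such that `S ∘ t = s` and
`S(a₁) a₂ = t(π(S(a)))`. -/
structure AntipodeBialgebroid extends LeftBialgebroid k A L where
  S : A ≃ₐ[k] Aᵐᵒᵖ
  S_t : ∀ l, (S (t (op l))).unop = s l
  S_mul : ∀ a x, (leftRel s t).mkQ x = comul a →
    LinearMap.mul' k A (TensorProduct.map
      ((opLinearEquiv k).symm.toLinearMap ∘ₗ S.toLinearMap) LinearMap.id x) =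
        t (op (counit (S a).unop))

namespace AntipodeBialgebroid

/-- The linear map `a ⊗ b ↦ S(b) ⊗ S(a)` on `A ⊗[k] A`. -/
def flipS (S : A ≃ₐ[k] Aᵐᵒᵖ) : A ⊗[k] A →ₗ[k] A ⊗[k] A :=
  TensorProduct.map ((opLinearEquiv k).symm.toLinearMap ∘ₗ S.toLinearMap)
    ((opLinearEquiv k).symm.toLinearMap ∘ₗ S.toLinearMap) ∘ₗ
      (TensorProduct.comm k A A).toLinearMap

theorem flipS_tmul (S : A ≃ₐ[k] Aᵐᵒᵖ) (a b : A) :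
    flipS S (a ⊗ₜ[k] b) = (S b).unop ⊗ₜ[k] (S a).unop := rfl

variable (B : AntipodeBialgebroid k A L)

theorem S_s (l : L) : (B.S (B.s l)).unop = B.t (op (B.counit (B.S (B.s l)).unop)) := by
  have h := B.comul_bimod l 1 1 (1 ⊗ₜ[k] 1) B.comul_one.symm
  simp only [op_one, map_one, mul_one] at h
  have h2 := B.S_mul (B.s l) _ h.symm
  simpa using h2

theorem flipS_leftRel :
    leftRel B.s B.t ≤ (rightRel B.s B.S).comap (flipS B.S) := by
  refine Submodule.span_le.2 ?_
  rintro _ ⟨l, a, b, rfl⟩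
  simp only [SetLike.mem_coe, Submodule.mem_comap, map_sub, flipS_tmul, map_mul, unop_mul, B.S_t]
  rw [← Submodule.neg_mem_iff, neg_sub]
  exact Submodule.subset_span ⟨l, _, _, rfl⟩

theorem flipS_rightRel :
    rightRel B.s B.S ≤ (leftRel B.s B.t).comap (flipS B.S) := by
  refine Submodule.span_le.2 ?_
  rintro _ ⟨l, a, b, rfl⟩
  simp only [SetLike.mem_coe, Submodule.mem_comap, map_sub, flipS_tmul, map_mul, unop_mul]
  rw [← Submodule.neg_mem_iff, neg_sub, B.S_s l, B.S_t]
  exact Submodule.subset_span ⟨_, _, _, rfl⟩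

/-- `A ⊗_L A → A ⊗_{L'} A`, `a ⊗ b ↦ S(b) ⊗ S(a)`. -/
def flipL : (A ⊗[k] A) ⧸ leftRel B.s B.t →ₗ[k] (A ⊗[k] A) ⧸ rightRel B.s B.S :=
  Submodule.mapQ _ _ (flipS B.S) B.flipS_leftRel

/-- `A ⊗_{L'} A → A ⊗_L A`, `a ⊗ b ↦ S(b) ⊗ S(a)`. -/
def flipR : (A ⊗[k] A) ⧸ rightRel B.s B.S →ₗ[k] (A ⊗[k] A) ⧸ leftRel B.s B.t :=
  Submodule.mapQ _ _ (flipS B.S) B.flipS_rightRel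

/-- The second comultiplication `Δ' = flipL ∘ Δ ∘ S⁻¹ : A → A ⊗_{L'} A`. -/
def comul' : A →ₗ[k] (A ⊗[k] A) ⧸ rightRel B.s B.S :=
  B.flipL ∘ₗ B.comul ∘ₗ B.S.symm.toLinearMap ∘ₗ (opLinearEquiv k).toLinearMap

end AntipodeBialgebroid

variable (k A L) in
/-- A Hopf algebroid `(A_L, S)` over `L`. -/
structure HopfAlgebroid extends AntipodeBialgebroid k A L where
  -- `(Δ ⊗ id) ∘ Δ' = (id ⊗ Δ') ∘ Δ` in `A ⊗_L A ⊗_{L'} A`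
  coassoc_left : ∀ a x y, (rightRel s S).mkQ x = toAntipodeBialgebroid.comul' a →
    (leftRel s t).mkQ y = comul a →
    tripleLeft (leftRel s t) (rightRel s S) (comul.rTensor A x) =
      tripleRight (leftRel s t) (rightRel s S) (toAntipodeBialgebroid.comul'.lTensor A y)
  -- `(Δ' ⊗ id) ∘ Δ = (id ⊗ Δ) ∘ Δ'` in `A ⊗_{L'} A ⊗_L A`
  coassoc_right : ∀ a x y, (leftRel s t).mkQ x = comul a →
    (rightRel s S).mkQ y = toAntipodeBialgebroid.comul' a →
    tripleLeft (rightRel s S) (leftRel s t) (toAntipodeBialgebroid.comul'.rTensor A x) =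
      tripleRight (rightRel s S) (leftRel s t) (comul.lTensor A y)
  flipR_bijective : Function.Bijective toAntipodeBialgebroid.flipR
  -- `Δ' = flipR⁻¹ ∘ Δ ∘ S`
  flipR_comul' : ∀ a, toAntipodeBialgebroid.flipR (toAntipodeBialgebroid.comul' a) =
    comul (S a).unop

end Algebroid

/-! ### Weak Hopf algebras and separability -/

section Weak

/-- `ε_t(a) = ε(1₁ a) 1₂` -/
def counitTarget (k : Type*) {A : Type*} [CommRing k] [Ring A] [Algebra k A] [Coalgebra k A]
    (a : A) : A :=
  TensorProduct.lid k A (TensorProduct.map (Coalgebra.counit ∘ₗ LinearMap.mulRight k a)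
    LinearMap.id (Coalgebra.comul (R := k) (1 : A)))

/-- `ε_s(a) = 1₁ ε(a 1₂)` -/
def counitSource (k : Type*) {A : Type*} [CommRing k] [Ring A] [Algebra k A] [Coalgebra k A]
    (a : A) : A :=
  TensorProduct.rid k A (TensorProduct.map LinearMap.id
    (Coalgebra.counit ∘ₗ LinearMap.mulLeft k a) (Coalgebra.comul (R := k) (1 : A)))

/-- A weak Hopf algebra structure over `k` on the `k`-algebra `A`. -/
class WeakHopfAlgebra (k A : Type*) [CommRing k] [Ring A] [Algebra k A]
    extends Coalgebra k A where
  comul_mul : ∀ a b : A, Coalgebra.comul (R := k) (a * b) =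
    Coalgebra.comul (R := k) a * Coalgebra.comul (R := k) b
  -- `(id ⊗ Δ)(Δ(1)) = (Δ(1) ⊗ 1)(1 ⊗ Δ(1)) = (1 ⊗ Δ(1))(Δ(1) ⊗ 1)`
  comul_one_left : (Coalgebra.comul (R := k)).lTensor A (Coalgebra.comul (R := k) (1 : A)) =
    TensorProduct.assoc k A A A (Coalgebra.comul (R := k) (1 : A) ⊗ₜ[k] 1) *
      ((1 : A) ⊗ₜ[k] Coalgebra.comul (R := k) (1 : A))
  comul_one_right : (Coalgebra.comul (R := k)).lTensor A (Coalgebra.comul (R := k) (1 : A)) =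
    ((1 : A) ⊗ₜ[k] Coalgebra.comul (R := k) (1 : A)) *
      TensorProduct.assoc k A A A (Coalgebra.comul (R := k) (1 : A) ⊗ₜ[k] 1)
  -- `ε(a b c) = ε(a b₁) ε(b₂ c) = ε(a b₂) ε(b₁ c)`
  counit_mul_left : ∀ a b c : A, Coalgebra.counit (R := k) (a * b * c) =
    LinearMap.mul' k k (TensorProduct.map (Coalgebra.counit ∘ₗ LinearMap.mulLeft k a)
      (Coalgebra.counit ∘ₗ LinearMap.mulRight k c) (Coalgebra.comul (R := k) b))
  counit_mul_right : ∀ a b c : A, Coalgebra.counit (R := k) (a * b * c) =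
    LinearMap.mul' k k (TensorProduct.map (Coalgebra.counit ∘ₗ LinearMap.mulRight k c)
      (Coalgebra.counit ∘ₗ LinearMap.mulLeft k a) (Coalgebra.comul (R := k) b))
  antipode : A →ₗ[k] A
  -- `a₁ S(a₂) = ε_t(a)`
  mul_antipode : ∀ a : A, LinearMap.mul' k A (antipode.lTensor A (Coalgebra.comul (R := k) a)) =
    counitTarget k a
  -- `S(a₁) a₂ = ε_s(a)`
  antipode_mul : ∀ a : A, LinearMap.mul' k A (antipode.rTensor A (Coalgebra.comul (R := k) a)) =
    counitSource k a
  -- `S(a₁) a₂ S(a₃) = S(a)`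
  antipode_mul_antipode : ∀ a : A, LinearMap.mul' k A (TensorProduct.map antipode
    (LinearMap.mul' k A ∘ₗ antipode.lTensor A ∘ₗ Coalgebra.comul (R := k))
      (Coalgebra.comul (R := k) a)) = antipode a

/-- The left bialgebroid `B` is the one underlying the weak Hopf algebra `A`: up to the
identification of `L` with the target subalgebra `ε_t(A)` along `s`, the source map of `B` is the
inclusion, the target map is `l ↦ 1₁ ε(1₂ l)`, the counit is `ε_t`, and the comultiplication is that
of the weak Hopf algebra followed by the projection `A ⊗[k] A → A ⊗_L A`. -/
structure LeftBialgebroid.IsUnderlying {k A L : Type*} [CommRing k] [Ring A] [Algebra k A]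
    [Ring L] [Algebra k L] (B : LeftBialgebroid k A L) (W : WeakHopfAlgebra k A) : Prop where
  s_counit : ∀ a, B.s (B.counit a) = counitTarget k a
  t_eq : ∀ l, B.t (op l) = TensorProduct.rid k A (TensorProduct.map LinearMap.id
    (Coalgebra.counit ∘ₗ LinearMap.mulRight k (B.s l)) (Coalgebra.comul (R := k) (1 : A)))
  comul_eq : ∀ a, B.comul a = (leftRel B.s B.t).mkQ (Coalgebra.comul (R := k) a)

/-- A left bialgebroid "is a weak Hopf algebra" if it underlies one. -/
def LeftBialgebroid.IsWeakHopf {k A L : Type*} [CommRing k] [Ring A] [Algebra k A]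
    [Ring L] [Algebra k L] (B : LeftBialgebroid k A L) : Prop :=
  ∃ W : WeakHopfAlgebra k A, B.IsUnderlying W

/-- The `k`-algebra `L` is separable with an idempotent Frobenius system. -/
def IsFrobeniusSeparable (k L : Type*) [CommRing k] [Ring L] [Algebra k L] : Prop :=
  ∃ (φ : L →ₗ[k] k) (e : L ⊗[k] L),
    (∀ l, TensorProduct.lid k L (TensorProduct.map (φ ∘ₗ LinearMap.mulLeft k l)
      LinearMap.id e) = l) ∧
    (∀ l, TensorProduct.rid k L (TensorProduct.map LinearMap.id
      (φ ∘ₗ LinearMap.mulRight k l) e) = l) ∧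
    LinearMap.mul' k L e = 1

end Weak

/-! ### The algebra `A_σ` -/

section Asigma

/-- The alphabet: the elements of `L ⊗ Lᵒᵖ` and the indeterminates `L_{ab}`, `(L⁻¹)_{ab}`. -/
inductive Gen (k L X : Type*) [CommRing k] [Ring L] [Algebra k L] where
  | base (ξ : L ⊗[k] Lᵐᵒᵖ)
  | ell (a b : X)
  | ellInv (a b : X)

variable (k : Type*) {L X G : Type*} [CommRing k] [Ring L] [Algebra k L] [Fintype X]
  [DecidableEq X] [Group G]

section Letters

variable (L X)

/-- An element of `L ⊗ Lᵒᵖ` as a letter of the free algebra. -/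
def fBase (ξ : L ⊗[k] Lᵐᵒᵖ) : FreeAlgebra k (Gen k L X) := FreeAlgebra.ι k (Gen.base ξ)

variable {X}

/-- The letter `L_{ab}`. -/
def fL (a b : X) : FreeAlgebra k (Gen k L X) := FreeAlgebra.ι k (Gen.ell a b)

/-- The letter `(L⁻¹)_{ab}`. -/
def fLInv (a b : X) : FreeAlgebra k (Gen k L X) := FreeAlgebra.ι k (Gen.ellInv a b)

end Letters

/-- The generators (differences of the two sides) of the ideal `I_σ`. Here `σ a b c d` stands for
`σ^{ab}_{cd}`. -/
inductive Rel (T : G → (L ≃ₐ[k] L)) (deg : X → G) (σ : X → X → X → X → L) :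
    FreeAlgebra k (Gen k L X) → FreeAlgebra k (Gen k L X) → Prop
  | add (ξ ξ' : L ⊗[k] Lᵐᵒᵖ) :
      Rel T deg σ (fBase k L X ξ + fBase k L X ξ') (fBase k L X (ξ + ξ'))
  | smul (c : k) (ξ : L ⊗[k] Lᵐᵒᵖ) :
      Rel T deg σ (c • fBase k L X ξ) (fBase k L X (c • ξ))
  | mul (ξ ξ' : L ⊗[k] Lᵐᵒᵖ) :
      Rel T deg σ (fBase k L X ξ * fBase k L X ξ') (fBase k L X (ξ * ξ'))
  | ell_ellInv (a b : X) :
      Rel T deg σ (∑ c, fL k L a c * fLInv k L c b) (if a = b then 1 else 0)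
  | ellInv_ell (a b : X) :
      Rel T deg σ (∑ c, fLInv k L a c * fL k L c b) (if a = b then 1 else 0)
  | s_ell (f : L) (a b : X) :
      Rel T deg σ (fBase k L X (T (deg a) f ⊗ₜ[k] 1) * fL k L a b)
        (fL k L a b * fBase k L X (f ⊗ₜ[k] 1))
  | t_ell (f : L) (a b : X) :
      Rel T deg σ (fBase k L X (1 ⊗ₜ[k] op (T (deg b) f)) * fL k L a b)
        (fL k L a b * fBase k L X (1 ⊗ₜ[k] op f))
  | s_ellInv (f : L) (a b : X) :
      Rel T deg σ (fBase k L X (f ⊗ₜ[k] 1) * fLInv k L a b)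
        (fLInv k L a b * fBase k L X (T (deg b) f ⊗ₜ[k] 1))
  | t_ellInv (f : L) (a b : X) :
      Rel T deg σ (fBase k L X (1 ⊗ₜ[k] op f) * fLInv k L a b)
        (fLInv k L a b * fBase k L X (1 ⊗ₜ[k] op (T (deg a) f)))
  | exchange (a b c d : X) :
      Rel T deg σ
        (∑ x, ∑ y, fBase k L X (σ x y a c ⊗ₜ[k] 1) * fL k L y d * fL k L x b)
        (∑ x, ∑ y, fBase k L X (1 ⊗ₜ[k] op (σ b d x y)) * fL k L c y * fL k L a x)
  | one : Rel T deg σ 1 (fBase k L X (1 ⊗ₜ[k] 1))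

variable (T : G → (L ≃ₐ[k] L)) (deg : X → G) (σ : X → X → X → X → L)

/-- The quotient `A_σ` of the free algebra by the two-sided ideal `I_σ`. -/
abbrev Asigma : Type _ := RingQuot (Rel k T deg σ)

/-- The class of an element of `L ⊗ Lᵒᵖ` in `A_σ`. -/
def base (ξ : L ⊗[k] Lᵐᵒᵖ) : Asigma k T deg σ :=
  RingQuot.mkAlgHom k (Rel k T deg σ) (fBase k L X ξ)

/-- The class of `L_{ab}` in `A_σ`. -/
def ell (a b : X) : Asigma k T deg σ := RingQuot.mkAlgHom k (Rel k T deg σ) (fL k L a b)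

/-- The class of `(L⁻¹)_{ab}` in `A_σ`. -/
def ellInv (a b : X) : Asigma k T deg σ := RingQuot.mkAlgHom k (Rel k T deg σ) (fLInv k L a b)

variable {k T deg σ} in
/-- The structure maps of a Hopf algebroid on `A_σ` are the standard ones. By multiplicativity they
are determined by these values on the generators. -/
structure IsStandard (H : HopfAlgebroid k (Asigma k T deg σ) L) : Prop where
  s_eq : ∀ l, H.s l = base k T deg σ (l ⊗ₜ[k] 1)
  t_eq : ∀ l, H.t (op l) = base k T deg σ (1 ⊗ₜ[k] op l)
  comul_ell : ∀ a b, H.comul (ell k T deg σ a b) =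
    (leftRel H.s H.t).mkQ (∑ c, ell k T deg σ a c ⊗ₜ[k] ell k T deg σ c b)
  comul_ellInv : ∀ a b, H.comul (ellInv k T deg σ a b) =
    (leftRel H.s H.t).mkQ (∑ c, ellInv k T deg σ c b ⊗ₜ[k] ellInv k T deg σ a c)
  counit_ell : ∀ a b, H.counit (ell k T deg σ a b) = if a = b then 1 else 0
  counit_ellInv : ∀ a b, H.counit (ellInv k T deg σ a b) = if a = b then 1 else 0
  S_s : ∀ l, H.S (base k T deg σ (l ⊗ₜ[k] 1)) = op (base k T deg σ (1 ⊗ₜ[k] op l))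
  S_t : ∀ l, H.S (base k T deg σ (1 ⊗ₜ[k] op l)) = op (base k T deg σ (l ⊗ₜ[k] 1))
  S_ell : ∀ a b, H.S (ell k T deg σ a b) = op (ellInv k T deg σ a b)

end Asigma

/-! ### The data given by a quasigroup -/

section Quasi

/-- A quasigroup. -/
class Quasigroup (Q : Type*) extends Mul Q where
  nonempty : Nonempty Q
  existsUnique_left : ∀ b c : Q, ∃! a, a * b = c
  existsUnique_right : ∀ a c : Q, ∃! b, a * b = c

/-- `a \ c`, the unique `b` with `a * b = c`. -/
def ldiv {Q : Type*} [Quasigroup Q] (a c : Q) : Q := (Quasigroup.existsUnique_right a c).choose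

/-- The conditions (QG1)--(QG5) on a ternary operation. -/
structure IsTernary {M : Type*} (μ : M → M → M → M) : Prop where
  qg1 : ∀ a b c d, μ a (μ a b c) (μ (μ a b c) c d) = μ a b (μ b c d)
  qg2 : ∀ a b c d, μ (μ a b c) c d = μ (μ a b (μ b c d)) (μ b c d) d
  qg3 : ∀ b c d, ∃! a, μ a b c = d
  qg4 : ∀ a c d, ∃! b, μ a b c = d
  qg5 : ∀ a b d, ∃! c, μ a b c = d

/-- `deg a` is the permutation `x ↦ x * a`, in the opposite of the symmetric group. -/
def qdeg {Q : Type*} [Quasigroup Q] (a : Q) : (Equiv.Perm Q)ᵐᵒᵖ :=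
  op (Equiv.ofBijective (fun x => x * a)
    ((Function.bijective_iff_existsUnique _).2 fun c => Quasigroup.existsUnique_left a c))

/-- `(T_α f)(x) = f(x α)` -/
def qT (k Q R : Type*) [CommRing k] [Ring R] [Algebra k R] (α : (Equiv.Perm Q)ᵐᵒᵖ) :
    (Q → R) ≃ₐ[k] (Q → R) where
  toFun f x := f (α.unop x)
  invFun f x := f (α.unop.symm x)
  left_inv f := by ext x; simp
  right_inv f := by ext x; simp
  map_mul' _ _ := rfl
  map_add' _ _ := rfl
  commutes' _ := rfl

/-- `σ^{ab}_{cd}`, where `p` is the bijection from the quasigroup to `M`. With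
`m = p⁻¹(μ(p(x), p(x b), p((x b) a)))`, the value at `x` is `1` if `c = m \ ((x b) a)` and
`d = x \ m`, and `0` otherwise. -/
def qσ {Q M : Type*} (R : Type*) [Quasigroup Q] [DecidableEq Q] [Ring R] (p : Q ≃ M)
    (μ : M → M → M → M) (a b c d : Q) : Q → R := fun x =>
  if c = ldiv (p.symm (μ (p x) (p (x * b)) (p ((x * b) * a)))) ((x * b) * a) ∧
      d = ldiv x (p.symm (μ (p x) (p (x * b)) (p ((x * b) * a)))) then 1 else 0

end Quasi

end

end HopfAlgd

/-! The algebra `A_σ` is universal among algebras with elements satisfying its defining relations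
(`Model`, `Model.lift`). Each structure map therefore comes from a suitable model, and each axiom is
checked by induction on generators (`standardModel_generates`).

The product on `A ⊗ A` does not descend to all of `A ⊗_L A`, so the comultiplication is built as a
representation. Elements of `A ⊗ A` that preserve the balancing relations act on `A ⊗_L A`
(`idealizerAct`), the matrix coproducts of `L_{ab}` and `(L⁻¹)_{ab}` are such elements, and Δ(a) is
the result of acting on the class of 1 ⊗ 1. Likewise π(a) is the result of acting on 1 in a
representation of `A_σ` on `L`, in which `L_{ab}` acts as δ_{ab} `T_a`. This representation exists
because σ preserves degrees (`weightZero_qσ`).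

The antipode is a model in the opposite algebra. It needs relations that are not among the defining
ones: the inverse relations with the products in the other order, and an exchange relation for `L⁻¹`
(`IsRigid`). This is where unique solvability of μ enters. Cutting with the idempotents of pairs of
vertices turns `L_{ab}` into faces u(l, l'; n, n'), and turns the exchange relation into the rule
that a product of two faces is unchanged when both middle vertices are moved by μ. Multiplying this
rule by inverse faces and summing gives `FaceSystem.u_mul_v`. Reindexing that identity along
bijections supplied by μ gives the missing inverse relations, and a second multiplication gives
`FaceSystem.v_mul_v`. The resulting S is involutive, and Δ' takes the same values on generators as
Δ, so one lemma (`Model.IsComul.coassoc`) proves ordinary and mixed coassociativity.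

For the last claim, if the bialgebroid underlies a weak Hopf algebra, then ε ∘ s and (π ⊗ π)(Δ_w(1))
form an idempotent Frobenius system on `L` (`LeftBialgebroid.IsUnderlying.isFrobeniusSeparable`).
Projecting to one coordinate of `Q → R` gives such a system on `R` (`IsFrobeniusSeparable.of_pi`).
-/

namespace HopfAlgd

noncomputable section

/-! ### The presentation of `A_σ` -/

section Presentation

variable {k L X G : Type*} [CommRing k] [Ring L] [Algebra k L] [Fintype X] [DecidableEq X]
variable (T : G → (L ≃ₐ[k] L)) (deg : X → G) (σ : X → X → X → X → L)

/-- `base` as a homomorphism of algebras. -/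
def baseHom : L ⊗[k] Lᵐᵒᵖ →ₐ[k] Asigma k T deg σ :=
  AlgHom.ofLinearMap
    { toFun := base k T deg σ
      map_add' := fun ξ ξ' => by
        have := RingQuot.mkAlgHom_rel k (Rel.add (T := T) (deg := deg) (σ := σ) ξ ξ')
        rw [map_add] at this
        exact this.symm
      map_smul' := fun c ξ => by
        have := RingQuot.mkAlgHom_rel k (Rel.smul (T := T) (deg := deg) (σ := σ) c ξ)
        rw [map_smul] at this
        exact this.symm }
    (by
      have := RingQuot.mkAlgHom_rel k (Rel.one (T := T) (deg := deg) (σ := σ))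
      rw [map_one] at this
      exact this.symm)
    (fun ξ ξ' => by
      have := RingQuot.mkAlgHom_rel k (Rel.mul (T := T) (deg := deg) (σ := σ) ξ ξ')
      rw [map_mul] at this
      exact this.symm)

/-- The source map `l ↦ l ⊗ 1`. -/
def source : L →ₐ[k] Asigma k T deg σ :=
  (baseHom T deg σ).comp Algebra.TensorProduct.includeLeft

/-- The target map `l ↦ 1 ⊗ l`. -/
def target : Lᵐᵒᵖ →ₐ[k] Asigma k T deg σ :=
  (baseHom T deg σ).comp Algebra.TensorProduct.includeRight

theorem baseHom_apply (ξ : L ⊗[k] Lᵐᵒᵖ) : baseHom T deg σ ξ = base k T deg σ ξ := rfl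

theorem source_apply (l : L) : source T deg σ l = base k T deg σ (l ⊗ₜ[k] 1) := rfl

theorem target_apply (l : Lᵐᵒᵖ) : target T deg σ l = base k T deg σ (1 ⊗ₜ[k] l) := rfl

theorem base_tmul (l : L) (l' : Lᵐᵒᵖ) :
    base k T deg σ (l ⊗ₜ[k] l') = source T deg σ l * target T deg σ l' := by
  rw [source_apply, target_apply, ← baseHom_apply, ← baseHom_apply, ← baseHom_apply, ← map_mul]
  simp

theorem source_mul_target (l : L) (l' : Lᵐᵒᵖ) :
    source T deg σ l * target T deg σ l' = target T deg σ l' * source T deg σ l := by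
  rw [source_apply, target_apply, ← baseHom_apply, ← baseHom_apply, ← map_mul, ← map_mul]
  simp

theorem sum_ell_ellInv (a b : X) :
    ∑ c, ell k T deg σ a c * ellInv k T deg σ c b = if a = b then 1 else 0 := by
  have := RingQuot.mkAlgHom_rel k (Rel.ell_ellInv (T := T) (deg := deg) (σ := σ) a b)
  rw [apply_ite (RingQuot.mkAlgHom k (Rel k T deg σ)), map_one, map_zero] at this
  simp only [map_sum, map_mul] at this
  exact this

theorem sum_ellInv_ell (a b : X) :
    ∑ c, ellInv k T deg σ a c * ell k T deg σ c b = if a = b then 1 else 0 := by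
  have := RingQuot.mkAlgHom_rel k (Rel.ellInv_ell (T := T) (deg := deg) (σ := σ) a b)
  rw [apply_ite (RingQuot.mkAlgHom k (Rel k T deg σ)), map_one, map_zero] at this
  simp only [map_sum, map_mul] at this
  exact this

theorem source_mul_ell (f : L) (a b : X) :
    source T deg σ (T (deg a) f) * ell k T deg σ a b = ell k T deg σ a b * source T deg σ f := by
  have := RingQuot.mkAlgHom_rel k (Rel.s_ell (T := T) (deg := deg) (σ := σ) f a b)
  simp only [map_mul] at this
  exact this

theorem target_mul_ell (f : L) (a b : X) :
    target T deg σ (op (T (deg b) f)) * ell k T deg σ a b =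
      ell k T deg σ a b * target T deg σ (op f) := by
  have := RingQuot.mkAlgHom_rel k (Rel.t_ell (T := T) (deg := deg) (σ := σ) f a b)
  simp only [map_mul] at this
  exact this

theorem source_mul_ellInv (f : L) (a b : X) :
    source T deg σ f * ellInv k T deg σ a b =
      ellInv k T deg σ a b * source T deg σ (T (deg b) f) := by
  have := RingQuot.mkAlgHom_rel k (Rel.s_ellInv (T := T) (deg := deg) (σ := σ) f a b)
  simp only [map_mul] at this
  exact this

theorem target_mul_ellInv (f : L) (a b : X) :
    target T deg σ (op f) * ellInv k T deg σ a b =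
      ellInv k T deg σ a b * target T deg σ (op (T (deg a) f)) := by
  have := RingQuot.mkAlgHom_rel k (Rel.t_ellInv (T := T) (deg := deg) (σ := σ) f a b)
  simp only [map_mul] at this
  exact this

theorem exchange_ell (a b c d : X) :
    ∑ x, ∑ y, source T deg σ (σ x y a c) * ell k T deg σ y d * ell k T deg σ x b =
      ∑ x, ∑ y, target T deg σ (op (σ b d x y)) * ell k T deg σ c y * ell k T deg σ a x := by
  have := RingQuot.mkAlgHom_rel k (Rel.exchange (T := T) (deg := deg) (σ := σ) a b c d)
  simp only [map_sum, map_mul] at this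
  exact this

/-- Elements of an algebra `E` satisfying the defining relations of `A_σ`. -/
structure Model (E : Type*) [Ring E] [Algebra k E] where
  src : L →ₐ[k] E
  tgt : Lᵐᵒᵖ →ₐ[k] E
  u : X → X → E
  v : X → X → E
  comm : ∀ l l', Commute (src l) (tgt l')
  u_v : ∀ a b, ∑ c, u a c * v c b = if a = b then 1 else 0
  v_u : ∀ a b, ∑ c, v a c * u c b = if a = b then 1 else 0
  src_u : ∀ f a b, src (T (deg a) f) * u a b = u a b * src f
  tgt_u : ∀ f a b, tgt (op (T (deg b) f)) * u a b = u a b * tgt (op f)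
  src_v : ∀ f a b, src f * v a b = v a b * src (T (deg b) f)
  tgt_v : ∀ f a b, tgt (op f) * v a b = v a b * tgt (op (T (deg a) f))
  exchange : ∀ a b c d, ∑ x, ∑ y, src (σ x y a c) * u y d * u x b =
    ∑ x, ∑ y, tgt (op (σ b d x y)) * u c y * u a x

/-- `A_σ` itself. -/
def standardModel : Model T deg σ (Asigma k T deg σ) where
  src := source T deg σ
  tgt := target T deg σ
  u := ell k T deg σ
  v := ellInv k T deg σ
  comm := source_mul_target T deg σ
  u_v := sum_ell_ellInv T deg σ
  v_u := sum_ellInv_ell T deg σ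
  src_u := source_mul_ell T deg σ
  tgt_u := target_mul_ell T deg σ
  src_v := source_mul_ellInv T deg σ
  tgt_v := target_mul_ellInv T deg σ
  exchange := exchange_ell T deg σ

variable {T deg σ}

namespace Model

/-- The model generates its algebra, as an induction principle. -/
def Generates {E : Type*} [Ring E] [Algebra k E] (m : Model T deg σ E) : Prop :=
  ∀ C : E → Prop, (∀ l, C (m.src l)) → (∀ l, C (m.tgt (op l))) → (∀ a b, C (m.u a b)) →
    (∀ a b, C (m.v a b)) → (∀ a b, C a → C b → C (a + b)) → (∀ a b, C a → C b → C (a * b)) →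
      ∀ a, C a

/-- The homomorphism `f` carries one model to another. -/
structure IsHom {E F : Type*} [Ring E] [Algebra k E] [Ring F] [Algebra k F] (m : Model T deg σ E)
    (m' : Model T deg σ F) (f : E →ₐ[k] F) : Prop where
  src : ∀ l, f (m.src l) = m'.src l
  tgt : ∀ l, f (m.tgt l) = m'.tgt l
  u : ∀ a b, f (m.u a b) = m'.u a b
  v : ∀ a b, f (m.v a b) = m'.v a b

variable {E : Type*} [Ring E] [Algebra k E] (m : Model T deg σ E)

/-- The values of the letters. -/
def letter : Gen k L X → E
  | .base ξ => Algebra.TensorProduct.lift m.src m.tgt m.comm ξ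
  | .ell a b => m.u a b
  | .ellInv a b => m.v a b

theorem lift_rel ⦃x y : FreeAlgebra k (Gen k L X)⦄ (h : Rel k T deg σ x y) :
    FreeAlgebra.lift k m.letter x = FreeAlgebra.lift k m.letter y := by
  induction h with
  | ell_ellInv a b =>
    rw [apply_ite (FreeAlgebra.lift k m.letter)]
    simpa [fL, fLInv, letter] using m.u_v a b
  | ellInv_ell a b =>
    rw [apply_ite (FreeAlgebra.lift k m.letter)]
    simpa [fL, fLInv, letter] using m.v_u a b
  | s_ell f a b => simpa [fBase, fL, letter] using m.src_u f a b
  | t_ell f a b => simpa [fBase, fL, letter] using m.tgt_u f a b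
  | s_ellInv f a b => simpa [fBase, fLInv, letter] using m.src_v f a b
  | t_ellInv f a b => simpa [fBase, fLInv, letter] using m.tgt_v f a b
  | exchange a b c d => simpa [fBase, fL, letter] using m.exchange a b c d
  | _ => simp [fBase, letter, Algebra.TensorProduct.one_def.symm]

/-- The universal property of `A_σ`. -/
def lift : Asigma k T deg σ →ₐ[k] E :=
  RingQuot.liftAlgHom k ⟨FreeAlgebra.lift k m.letter, m.lift_rel⟩

theorem isHom_lift : (standardModel T deg σ).IsHom m m.lift where
  src l := by simp [lift, standardModel, source_apply, base, fBase, letter]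
  tgt l := by simp [lift, standardModel, target_apply, base, fBase, letter]
  u a b := by simp [lift, standardModel, ell, fL, letter]
  v a b := by simp [lift, standardModel, ellInv, fLInv, letter]

end Model

-- Scalars need no case of their own in `Generates`, since they are values of `src`. Elements of `L
-- ⊗ Lᵒᵖ` reduce to products of values of `src` and `tgt`.
variable (T deg σ) in
theorem standardModel_generates : (standardModel T deg σ).Generates := by
  intro C hs ht hu hv hadd hmul a
  obtain ⟨x, rfl⟩ := RingQuot.mkAlgHom_surjective k (Rel k T deg σ) a
  induction x using FreeAlgebra.induction with
  | grade0 r =>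
    rw [AlgHom.commutes, ← (standardModel T deg σ).src.commutes]
    exact hs _
  | grade1 g =>
    cases g with
    | base ξ =>
      change C (baseHom T deg σ ξ)
      induction ξ using TensorProduct.induction_on with
      | zero => rw [map_zero, ← map_zero (standardModel T deg σ).src]; exact hs _
      | tmul l l' => rw [baseHom_apply, base_tmul]; exact hmul _ _ (hs _) (ht l'.unop)
      | add x y hx hy => rw [map_add]; exact hadd _ _ hx hy
    | ell a b => exact hu a b
    | ellInv a b => exact hv a b
  | mul x y hx hy => rw [map_mul]; exact hmul _ _ hx hy
  | add x y hx hy => rw [map_add]; exact hadd _ _ hx hy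

end Presentation

/-! ### Coassociativity through multiplicative lifts -/

section Lifts

variable {k A : Type*} [CommRing k] [Ring A] [Algebra k A]

/-- A unital and multiplicative map into a quotient of `A ⊗ A`. -/
structure IsMultiplicative {P : Submodule k (A ⊗[k] A)} (D : A →ₗ[k] (A ⊗[k] A) ⧸ P) : Prop where
  map_one : D 1 = P.mkQ 1
  map_mul : ∀ a b x y, P.mkQ x = D a → P.mkQ y = D b → D (a * b) = P.mkQ (x * y)

/-- Left multiplication by `x` is carried to left multiplication by `Z` under `D ⊗ id`. -/
def LeftLift {P : Submodule k (A ⊗[k] A)} (D : A →ₗ[k] (A ⊗[k] A) ⧸ P)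
    (x : A ⊗[k] A) (Z : (A ⊗[k] A) ⊗[k] A) : Prop :=
  ∀ y Y, D.rTensor A y = P.mkQ.rTensor A Y → D.rTensor A (x * y) = P.mkQ.rTensor A (Z * Y)

/-- Left multiplication by `x` is carried to left multiplication by `Z` under `id ⊗ D`. -/
def RightLift {P : Submodule k (A ⊗[k] A)} (D : A →ₗ[k] (A ⊗[k] A) ⧸ P)
    (x : A ⊗[k] A) (Z : A ⊗[k] (A ⊗[k] A)) : Prop :=
  ∀ y Y, D.lTensor A y = P.mkQ.lTensor A Y → D.lTensor A (x * y) = P.mkQ.lTensor A (Z * Y)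

variable {P : Submodule k (A ⊗[k] A)} {D : A →ₗ[k] (A ⊗[k] A) ⧸ P}

theorem LeftLift.add {x x' Z Z'} (h : LeftLift D x Z) (h' : LeftLift D x' Z') :
    LeftLift D (x + x') (Z + Z') := fun y Y e => by
  rw [add_mul, add_mul, map_add, map_add, h y Y e, h' y Y e]

theorem LeftLift.mul {x x' Z Z'} (h : LeftLift D x Z) (h' : LeftLift D x' Z') :
    LeftLift D (x * x') (Z * Z') := fun y Y e => by
  rw [mul_assoc, mul_assoc]; exact h _ _ (h' y Y e)

theorem LeftLift.sum {ι : Type*} (s : Finset ι) {x : ι → A ⊗[k] A} {Z : ι → (A ⊗[k] A) ⊗[k] A}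
    (h : ∀ i, LeftLift D (x i) (Z i)) : LeftLift D (∑ i ∈ s, x i) (∑ i ∈ s, Z i) := fun y Y e => by
  simp only [Finset.sum_mul, map_sum]
  exact Finset.sum_congr rfl fun i _ => h i y Y e

theorem RightLift.add {x x' Z Z'} (h : RightLift D x Z) (h' : RightLift D x' Z') :
    RightLift D (x + x') (Z + Z') := fun y Y e => by
  rw [add_mul, add_mul, map_add, map_add, h y Y e, h' y Y e]

theorem RightLift.mul {x x' Z Z'} (h : RightLift D x Z) (h' : RightLift D x' Z') :
    RightLift D (x * x') (Z * Z') := fun y Y e => by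
  rw [mul_assoc, mul_assoc]; exact h _ _ (h' y Y e)

theorem RightLift.sum {ι : Type*} (s : Finset ι) {x : ι → A ⊗[k] A} {Z : ι → A ⊗[k] (A ⊗[k] A)}
    (h : ∀ i, RightLift D (x i) (Z i)) : RightLift D (∑ i ∈ s, x i) (∑ i ∈ s, Z i) :=
  fun y Y e => by
  simp only [Finset.sum_mul, map_sum]
  exact Finset.sum_congr rfl fun i _ => h i y Y e

/-- Any element `p` of `P` represents `D 0 = 0`, so multiplicativity applied to `a * 0` forces `X *
p` into `P`. Left multiplication by `X` thus descends to the quotient, where `mapQ_apply` identifies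
its effect on the image of `D`. -/
theorem IsMultiplicative.le_comap (hD : IsMultiplicative D) {a : A} {X : A ⊗[k] A}
    (hX : P.mkQ X = D a) : P ≤ P.comap (LinearMap.mulLeft k X) := fun p hp => by
  have := hD.map_mul a 0 X p hX (by rw [map_zero]; exact (Submodule.Quotient.mk_eq_zero P).2 hp)
  rw [mul_zero, map_zero] at this
  exact (Submodule.Quotient.mk_eq_zero P).1 this.symm

theorem IsMultiplicative.mapQ_apply (hD : IsMultiplicative D) {a : A} {X : A ⊗[k] A}
    (hX : P.mkQ X = D a) (b : A) :
    P.mapQ P (LinearMap.mulLeft k X) (hD.le_comap hX) (D b) = D (a * b) := by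
  obtain ⟨Y, hY⟩ := P.mkQ_surjective (D b)
  rw [← hY, hD.map_mul a b X Y hX hY]
  rfl

/-- The operator induced by `X` on the quotient, tensored with multiplication by `b`, intertwines
both left multiplications: along `D ⊗ id` and along the projection. -/
theorem IsMultiplicative.leftLift (hD : IsMultiplicative D) {a : A} {X : A ⊗[k] A}
    (hX : P.mkQ X = D a) (b : A) : LeftLift D (a ⊗ₜ b) (X ⊗ₜ b) := fun y Y e => by
  have h1 : D.rTensor A ∘ₗ LinearMap.mulLeft k (a ⊗ₜ[k] b) =
      TensorProduct.map (P.mapQ P (LinearMap.mulLeft k X) (hD.le_comap hX))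
        (LinearMap.mulLeft k b) ∘ₗ D.rTensor A := by
    ext u v
    simp [hD.mapQ_apply hX]
  have h2 : P.mkQ.rTensor A ∘ₗ LinearMap.mulLeft k (X ⊗ₜ[k] b) =
      TensorProduct.map (P.mapQ P (LinearMap.mulLeft k X) (hD.le_comap hX))
        (LinearMap.mulLeft k b) ∘ₗ P.mkQ.rTensor A := by
    refine TensorProduct.ext' fun u v => ?_
    simp
  have h1 := LinearMap.congr_fun h1 y
  have h2 := LinearMap.congr_fun h2 Y
  simp only [LinearMap.comp_apply, LinearMap.mulLeft_apply] at h1 h2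
  rw [h1, h2, e]

theorem IsMultiplicative.rightLift (hD : IsMultiplicative D) {a : A} {X : A ⊗[k] A}
    (hX : P.mkQ X = D a) (b : A) : RightLift D (b ⊗ₜ a) (b ⊗ₜ X) := fun y Y e => by
  have h1 : D.lTensor A ∘ₗ LinearMap.mulLeft k (b ⊗ₜ[k] a) =
      TensorProduct.map (LinearMap.mulLeft k b)
        (P.mapQ P (LinearMap.mulLeft k X) (hD.le_comap hX)) ∘ₗ D.lTensor A := by
    ext u v
    simp [hD.mapQ_apply hX]
  have h2 : P.mkQ.lTensor A ∘ₗ LinearMap.mulLeft k (b ⊗ₜ[k] X) =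
      TensorProduct.map (LinearMap.mulLeft k b)
        (P.mapQ P (LinearMap.mulLeft k X) (hD.le_comap hX)) ∘ₗ P.mkQ.lTensor A := by
    refine TensorProduct.ext' fun u v => ?_
    simp
  have h1 := LinearMap.congr_fun h1 y
  have h2 := LinearMap.congr_fun h2 Y
  simp only [LinearMap.comp_apply, LinearMap.mulLeft_apply] at h1 h2
  rw [h1, h2, e]

theorem LeftLift.rTensor_eq {x Z} (h : LeftLift D x Z) (h1 : D 1 = P.mkQ 1) :
    D.rTensor A x = P.mkQ.rTensor A Z := by
  have := h 1 1 (by simp only [Algebra.TensorProduct.one_def, LinearMap.rTensor_tmul, h1])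
  rwa [mul_one, mul_one] at this

theorem RightLift.lTensor_eq {x Z} (h : RightLift D x Z) (h1 : D 1 = P.mkQ 1) :
    D.lTensor A x = P.mkQ.lTensor A Z := by
  have := h 1 1 (by simp only [Algebra.TensorProduct.one_def, LinearMap.lTensor_tmul, h1])
  rwa [mul_one, mul_one] at this

theorem tripleLeft_rTensor_mkQ (P Q : Submodule k (A ⊗[k] A)) (Z : (A ⊗[k] A) ⊗[k] A) :
    tripleLeft P Q (P.mkQ.rTensor A Z) =
      (tripleRel P Q).mkQ (Algebra.TensorProduct.assoc k k k A A A Z) := by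
  induction Z using TensorProduct.induction_on with
  | zero => simp only [map_zero]
  | tmul u v => rfl
  | add u v hu hv => simp only [map_add, hu, hv]

theorem tripleRight_lTensor_mkQ (P Q : Submodule k (A ⊗[k] A)) (Z : A ⊗[k] (A ⊗[k] A)) :
    tripleRight P Q (Q.mkQ.lTensor A Z) = (tripleRel P Q).mkQ Z := by
  induction Z using TensorProduct.induction_on with
  | zero => simp only [map_zero]
  | tmul u v => rfl
  | add u v hu hv => simp only [map_add, hu, hv]

/-- Evaluating both lifts at 1 shows that each side is the class of the same element `Z` of the
triple tensor product. -/
theorem tripleLeft_eq_tripleRight {Q : Submodule k (A ⊗[k] A)} {E : A →ₗ[k] (A ⊗[k] A) ⧸ Q}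
    (hD : D 1 = P.mkQ 1) (hE : E 1 = Q.mkQ 1) {x Z} (hl : LeftLift D x Z)
    (hr : RightLift E x (Algebra.TensorProduct.assoc k k k A A A Z)) :
    tripleLeft P Q (D.rTensor A x) = tripleRight P Q (E.lTensor A x) := by
  rw [hl.rTensor_eq hD, hr.lTensor_eq hE, tripleLeft_rTensor_mkQ, tripleRight_lTensor_mkQ]

/-- This makes the left-hand side of coassociativity independent of the representative. By `h`, the
action `ρ l` passes through `D` to the second tensor factor, where it meets the third across the
balanced sign. -/
theorem tripleLeft_balanced {ι : Type*} (ρ : ι → A →ₗ[k] A) (g : ι → A → A)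
    (h : ∀ l a X, P.mkQ X = D a → D (ρ l a) = P.mkQ ((ρ l).lTensor A X))
    {q : A ⊗[k] A} (hq : q ∈ balanced k (fun l a => ρ l a) g) :
    tripleLeft P (balanced k (fun l a => ρ l a) g) (D.rTensor A q) = 0 := by
  set Q := balanced k (fun l a => ρ l a) g with hQ
  suffices Q ≤ LinearMap.ker (tripleLeft P Q ∘ₗ D.rTensor A) from LinearMap.mem_ker.1 (this hq)
  refine Submodule.span_le.2 ?_
  rintro _ ⟨l, a, b, rfl⟩
  obtain ⟨X, hX⟩ := P.mkQ_surjective (D a)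
  rw [SetLike.mem_coe, LinearMap.mem_ker, map_sub, sub_eq_zero]
  simp only [LinearMap.comp_apply, LinearMap.rTensor_tmul, h l a X hX, ← hX]
  clear hX
  induction X using TensorProduct.induction_on with
  | zero => simp only [map_zero, TensorProduct.zero_tmul]
  | add u v hu hv => simp only [map_add, TensorProduct.add_tmul, hu, hv]
  | tmul u v =>
    change (tripleRel P Q).mkQ (u ⊗ₜ (ρ l v ⊗ₜ b)) = (tripleRel P Q).mkQ (u ⊗ₜ (v ⊗ₜ g l b))
    rw [← sub_eq_zero, ← map_sub, ← TensorProduct.tmul_sub]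
    exact (Submodule.Quotient.mk_eq_zero _).2 (Submodule.mem_sup_right
      ⟨u ⊗ₜ ⟨_, Submodule.subset_span ⟨l, v, b, rfl⟩⟩, rfl⟩)

theorem tripleRight_balanced {ι : Type*} (r : ι → A → A) (γ : ι → A →ₗ[k] A)
    (h : ∀ l b X, P.mkQ X = D b → D (γ l b) = P.mkQ ((γ l).rTensor A X))
    {q : A ⊗[k] A} (hq : q ∈ balanced k r (fun l b => γ l b)) :
    tripleRight (balanced k r (fun l b => γ l b)) P (D.lTensor A q) = 0 := by
  set Q := balanced k r (fun l b => γ l b) with hQ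
  suffices Q ≤ LinearMap.ker (tripleRight Q P ∘ₗ D.lTensor A) from LinearMap.mem_ker.1 (this hq)
  refine Submodule.span_le.2 ?_
  rintro _ ⟨l, a, b, rfl⟩
  obtain ⟨X, hX⟩ := P.mkQ_surjective (D b)
  rw [SetLike.mem_coe, LinearMap.mem_ker, map_sub, sub_eq_zero]
  simp only [LinearMap.comp_apply, LinearMap.lTensor_tmul, h l b X hX, ← hX]
  clear hX
  induction X using TensorProduct.induction_on with
  | zero => simp only [map_zero, TensorProduct.tmul_zero]
  | add u v hu hv => simp only [map_add, TensorProduct.tmul_add, hu, hv]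
  | tmul u v =>
    change (tripleRel Q P).mkQ (r l a ⊗ₜ (u ⊗ₜ v)) = (tripleRel Q P).mkQ (a ⊗ₜ (γ l u ⊗ₜ v))
    rw [← sub_eq_zero, ← map_sub]
    exact (Submodule.Quotient.mk_eq_zero _).2 (Submodule.mem_sup_left
      ⟨_, ⟨⟨_, Submodule.subset_span ⟨l, a, u, rfl⟩⟩ ⊗ₜ v, rfl⟩, by
        simp [TensorProduct.sub_tmul]⟩)

end Lifts

/-! ### Faces

A family `u(λ, λ'; ν, ν')` of elements indexed by two edges, with inverse `v`, and a ternary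
operation on the vertices moving the middle vertex of paths of length two. -/

section Faces

/-- Unique solvability of `μ a b c = d` in each of `a`, `b`, `c`. -/
structure UniquelySolvable {M : Type*} (μ : M → M → M → M) : Prop where
  left : ∀ b c d, ∃! a, μ a b c = d
  mid : ∀ a c d, ∃! b, μ a b c = d
  right : ∀ a b d, ∃! c, μ a b c = d

/-- Faces over the vertex set `M` with values in `A`. The face `u l l' n n'` leads from the pair of
vertices `(l, n)` to `(l', n')`, and `v l l' n n'` leads back. -/
structure FaceSystem (M A : Type*) [Fintype M] [DecidableEq M] [Ring A] where
  e : M → M → A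
  u : M → M → M → M → A
  v : M → M → M → M → A
  e_u : ∀ l l' n n', e l n * u l l' n n' = u l l' n n'
  u_e : ∀ l l' n n', u l l' n n' * e l' n' = u l l' n n'
  e_v : ∀ l l' n n', e l' n' * v l l' n n' = v l l' n n'
  v_e : ∀ l l' n n', v l l' n n' * e l n = v l l' n n'
  u_v : ∀ l₁ l₂ l' n, ∑ n', u l₁ l' n n' * v l₂ l' n n' = if l₁ = l₂ then e l₁ n else 0
  v_u : ∀ l' n n₁ n₂, ∑ l, v l l' n n₁ * u l l' n n₂ = if n₁ = n₂ then e l' n₁ else 0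

namespace FaceSystem

variable {M A : Type*} [Fintype M] [DecidableEq M] [Ring A] {F : FaceSystem M A}
  {μ : M → M → M → M}

/-- The exchange relation for paths of length two. -/
def Exchange (F : FaceSystem M A) (μ : M → M → M → M) : Prop :=
  ∀ l l₁ l₂ n n₁ n₂, F.u l l₁ n n₁ * F.u l₁ l₂ n₁ n₂ =
    F.u l (μ l l₁ l₂) n (μ n n₁ n₂) * F.u (μ l l₁ l₂) l₂ (μ n n₁ n₂) n₂

/-- Take the exchange relation with `m` and `m'` as moved middle vertices, multiply on the left by
`v l' m n m'` and sum over `l'`, then multiply on the right by `v l₁ l₂ n₁ z` and sum over `z`. The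
relations `v_u` and `u_v` produce Kronecker deltas, and unique solvability leaves one term on each
side. -/
theorem u_mul_v (hμ : UniquelySolvable μ) (hF : F.Exchange μ) (l l₁ l₂ n n₁ n₂ : M) :
    F.u (μ l l₁ l₂) l₂ (μ n n₁ n₂) n₂ * F.v l₁ l₂ n₁ n₂ =
      F.v l (μ l l₁ l₂) n (μ n n₁ n₂) * F.u l l₁ n n₁ := by
  set m := μ l l₁ l₂ with hm
  set m' := μ n n₁ n₂ with hm'
  -- For each start `l'`, the vertex `g l'` is the one that `μ` moves to the fixed vertex `m` on a
  -- path from `l'` to `l₂`.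
  choose g hg hg' using fun l' => (hμ.mid l' l₂ m)
  have key (z) : (if m' = μ n n₁ z then F.u m l₂ m' z else 0) =
      ∑ l', F.v l' m n m' * (F.u l' (g l') n n₁ * F.u (g l') l₂ n₁ z) := by
    calc (if m' = μ n n₁ z then F.u m l₂ m' z else 0)
        = (∑ l', F.v l' m n m' * F.u l' m n (μ n n₁ z)) * F.u m l₂ (μ n n₁ z) z := by
          rw [F.v_u]
          split_ifs with h
          · rw [← h, F.e_u]
          · rw [zero_mul]
      _ = _ := by
          rw [Finset.sum_mul]
          refine Finset.sum_congr rfl fun l' _ => ?_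
          rw [hF l' (g l') l₂ n n₁ z, show μ l' (g l') l₂ = m from hg l', mul_assoc]
  have h1 : ∑ z, (if m' = μ n n₁ z then F.u m l₂ m' z else 0) * F.v l₁ l₂ n₁ z =
      F.u m l₂ m' n₂ * F.v l₁ l₂ n₁ n₂ := by
    rw [Finset.sum_eq_single n₂ (fun z _ hz => ?_) (by simp), if_pos rfl]
    rw [if_neg, zero_mul]
    exact fun h => hz ((hμ.right n n₁ m').unique h.symm rfl)
  rw [← h1]
  simp_rw [key, Finset.sum_mul]
  rw [Finset.sum_comm, Finset.sum_eq_single l (fun l' _ hl' => ?_) (by simp)]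
  · simp_rw [mul_assoc]
    rw [← Finset.mul_sum, ← Finset.mul_sum, F.u_v, if_pos ((hμ.mid l l₂ m).unique (hg l) rfl)]
    rw [(hμ.mid l l₂ m).unique (hg l) (rfl : μ l l₁ l₂ = m), F.u_e]
  · simp_rw [mul_assoc]
    rw [← Finset.mul_sum, ← Finset.mul_sum, F.u_v, if_neg, mul_zero, mul_zero]
    intro h
    exact hl' ((hμ.left l₁ l₂ m).unique (h ▸ hg l') rfl)

/-- With `n` chosen so that `μ n n₂ n' = n₁`, the identity `u_mul_v` matches the terms with those of
the defining relation `v_u`. The matching of summation indices is the bijection `g` given by `μ l' l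
(g l') = l`. -/
theorem sum_u_mul_v (hμ : UniquelySolvable μ) (hF : F.Exchange μ) (l n₁ n₂ n' : M) :
    ∑ l', F.u l l' n₁ n' * F.v l l' n₂ n' = if n₁ = n₂ then F.e l n₁ else 0 := by
  obtain ⟨n, hn, -⟩ := hμ.left n₂ n' n₁
  rw [← F.v_u l n]
  choose g hg hg' using fun l' => (hμ.right l' l l)
  have hb : Function.Bijective g := by
    rw [← Finite.injective_iff_bijective]
    intro a b hab
    refine (hμ.left l (g a) l).unique (hg a) ?_
    rw [hab]; exact hg b
  rw [← hb.sum_comp]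
  refine Finset.sum_congr rfl fun l' _ => ?_
  have := u_mul_v hμ hF l' l (g l') n n₂ n'
  rwa [show μ l' l (g l') = l from hg l', hn] at this

/-- The mirror argument: with `μ l l₂ l' = l₁`, the terms match those of `u_v` along the bijection
given by `μ n n' (g n) = n'`. -/
theorem sum_v_mul_u (hμ : UniquelySolvable μ) (hF : F.Exchange μ) (l l₁ l₂ n' : M) :
    ∑ n, F.v l l₁ n n' * F.u l l₂ n n' = if l₁ = l₂ then F.e l₁ n' else 0 := by
  obtain ⟨l', hl, -⟩ := hμ.right l l₂ l₁
  rw [← F.u_v l₁ l₂ l']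
  choose g hg hg' using fun n => (hμ.right n n' n')
  have hb : Function.Bijective g := by
    rw [← Finite.injective_iff_bijective]
    intro a b hab
    refine (hμ.left n' (g a) n').unique (hg a) ?_
    rw [hab]; exact hg b
  rw [← hb.sum_comp fun z => F.u l₁ l' n' z * F.v l₂ l' n' z]
  refine Finset.sum_congr rfl fun n _ => ?_
  have := u_mul_v hμ hF l l₂ l' n n' (g n)
  rw [show μ n n' (g n) = n' from hg n, hl] at this
  exact this.symm

/-- The same double cancellation, now starting from `u_mul_v`: an inverse face on the left removes
its first `u`, one on the right removes its last `u`, and only inverse faces remain. -/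
theorem v_mul_v (hμ : UniquelySolvable μ) (hF : F.Exchange μ) (l l₁ l₂ n n₁ n₂ : M) :
    F.v l₁ l₂ n₁ n₂ * F.v l l₁ n n₁ =
      F.v (μ l l₁ l₂) l₂ (μ n n₁ n₂) n₂ * F.v l (μ l l₁ l₂) n (μ n n₁ n₂) := by
  set m' := μ n n₁ n₂ with hm'
  choose f hf hf' using fun m => (hμ.left l₁ l₂ m)
  choose g hg hg' using fun z => (hμ.right n z m')
  have key (z) : (if n₂ = g z then F.v l₁ l₂ z n₂ else 0) =
      ∑ m, F.v m l₂ m' n₂ * (F.v (f m) m n m' * F.u (f m) l₁ n z) := by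
    calc (if n₂ = g z then F.v l₁ l₂ z n₂ else 0)
        = (∑ m, F.v m l₂ m' n₂ * F.u m l₂ m' (g z)) * F.v l₁ l₂ z (g z) := by
          rw [F.v_u]
          split_ifs with h
          · rw [← h, F.e_v]
          · rw [zero_mul]
      _ = _ := by
          rw [Finset.sum_mul]
          refine Finset.sum_congr rfl fun m _ => ?_
          have := u_mul_v hμ hF (f m) l₁ l₂ n z (g z)
          rw [show μ (f m) l₁ l₂ = m from hf m, show μ n z (g z) = m' from hg z] at this
          rw [mul_assoc, this]
  have h1 : ∑ z, (if n₂ = g z then F.v l₁ l₂ z n₂ else 0) * F.v l l₁ n z =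
      F.v l₁ l₂ n₁ n₂ * F.v l l₁ n n₁ := by
    rw [Finset.sum_eq_single n₁ (fun z _ hz => ?_) (by simp),
      if_pos ((hμ.right n n₁ m').unique rfl (hg n₁))]
    rw [if_neg, zero_mul]
    exact fun h => hz ((hμ.mid n n₂ m').unique (h ▸ hg z) rfl)
  have hfl : f (μ l l₁ l₂) = l := (hμ.left l₁ l₂ _).unique (hf _) rfl
  rw [← h1]
  simp_rw [key, Finset.sum_mul]
  rw [Finset.sum_comm, Finset.sum_eq_single (μ l l₁ l₂) (fun m _ hm => ?_) (by simp)]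
  · simp_rw [mul_assoc]
    rw [← Finset.mul_sum, ← Finset.mul_sum, F.u_v, if_pos hfl, hfl, F.v_e]
  · simp_rw [mul_assoc]
    rw [← Finset.mul_sum, ← Finset.mul_sum, F.u_v, if_neg, mul_zero, mul_zero]
    rintro rfl
    exact hm (hf m).symm

end FaceSystem

end Faces

/-! ### The comultiplication of `A_σ` -/

section Idealizer

variable {k A L : Type*} [CommRing k] [Ring A] [Algebra k A] [Ring L] [Algebra k L]
  (s : L →ₐ[k] A) (t : Lᵐᵒᵖ →ₐ[k] A)

theorem mkQ_target_mul_tmul (l : L) (a b : A) :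
    (leftRel s t).mkQ ((t (op l) * a) ⊗ₜ b) = (leftRel s t).mkQ (a ⊗ₜ (s l * b)) := by
  rw [← sub_eq_zero, ← map_sub]
  exact (Submodule.Quotient.mk_eq_zero _).2 (Submodule.subset_span ⟨l, a, b, rfl⟩)

variable {s t} in
theorem mul_mem_leftRel {x : A ⊗[k] A} (hx : x ∈ leftRel s t) (y : A ⊗[k] A) :
    x * y ∈ leftRel s t := by
  suffices leftRel s t ≤ (leftRel s t).comap (LinearMap.mulRight k y) from this hx
  refine Submodule.span_le.2 ?_
  rintro _ ⟨l, a, b, rfl⟩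
  simp only [SetLike.mem_coe, Submodule.mem_comap, LinearMap.mulRight_apply]
  induction y using TensorProduct.induction_on with
  | zero => rw [mul_zero]; exact zero_mem _
  | add u v hu hv => rw [mul_add]; exact add_mem hu hv
  | tmul u v =>
    refine Submodule.subset_span ⟨l, a * u, b * v, ?_⟩
    simp only [sub_mul, Algebra.TensorProduct.tmul_mul_tmul, mul_assoc]

theorem mkQ_mul_right {x x' : A ⊗[k] A} (h : (leftRel s t).mkQ x = (leftRel s t).mkQ x')
    (y : A ⊗[k] A) : (leftRel s t).mkQ (x * y) = (leftRel s t).mkQ (x' * y) := by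
  rw [← sub_eq_zero, ← map_sub] at h ⊢
  rw [← sub_mul]
  exact (Submodule.Quotient.mk_eq_zero _).2
    (mul_mem_leftRel ((Submodule.Quotient.mk_eq_zero _).1 h) y)

/-- The elements of `A ⊗ A` whose left multiplications descend to `A ⊗_L A`. -/
def idealizer : Subalgebra k (A ⊗[k] A) where
  carrier := {X | ∀ p ∈ leftRel s t, X * p ∈ leftRel s t}
  mul_mem' hX hY p hp := by rw [mul_assoc]; exact hX _ (hY p hp)
  add_mem' hX hY p hp := by rw [add_mul]; exact add_mem (hX p hp) (hY p hp)
  algebraMap_mem' r p hp := by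
    rw [Algebra.algebraMap_eq_smul_one, smul_mul_assoc, one_mul]; exact Submodule.smul_mem _ _ hp

/-- The balancing relations form the right ideal generated by `t(l) ⊗ 1 - 1 ⊗ s(l)`, so stability
need only be tested on these generators. This is the Takeuchi condition. -/
theorem mem_idealizer {X : A ⊗[k] A}
    (h : ∀ l, (leftRel s t).mkQ (X * (t (op l) ⊗ₜ 1)) = (leftRel s t).mkQ (X * (1 ⊗ₜ s l))) :
    X ∈ idealizer s t := by
  intro p hp
  suffices leftRel s t ≤ (leftRel s t).comap (LinearMap.mulLeft k X) from this hp
  refine Submodule.span_le.2 ?_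
  rintro _ ⟨l, a, b, rfl⟩
  have := mkQ_mul_right s t (h l) (a ⊗ₜ b)
  rw [← sub_eq_zero, ← map_sub, mul_assoc, mul_assoc, ← mul_sub] at this
  simpa [Submodule.Quotient.mk_eq_zero, -Submodule.Quotient.mk_sub] using this

/-- The action of the idealizer on `A ⊗_L A`. -/
def idealizerAct : idealizer s t →ₐ[k] Module.End k ((A ⊗[k] A) ⧸ leftRel s t) :=
  AlgHom.ofLinearMap
    { toFun := fun X => (leftRel s t).mapQ _ (LinearMap.mulLeft k (X : A ⊗[k] A)) X.2
      map_add' := fun X Y => by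
        ext : 1
        refine LinearMap.ext fun y => ?_
        change (leftRel s t).mkQ ((X + Y : A ⊗[k] A) * y) = _
        rw [add_mul, map_add]; rfl
      map_smul' := fun c X => by
        ext : 1
        refine LinearMap.ext fun y => ?_
        change (leftRel s t).mkQ ((c • (X : A ⊗[k] A)) * y) = _
        rw [smul_mul_assoc, map_smul]; rfl }
    (by
      ext : 1
      refine LinearMap.ext fun y => ?_
      change (leftRel s t).mkQ ((1 : A ⊗[k] A) * y) = _
      rw [one_mul]; rfl)
    (fun X Y => by
      ext : 1
      refine LinearMap.ext fun y => ?_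
      change (leftRel s t).mkQ ((X * Y : A ⊗[k] A) * y) = _
      rw [mul_assoc]; rfl)

theorem idealizerAct_mkQ (X : idealizer s t) (y : A ⊗[k] A) :
    idealizerAct s t X ((leftRel s t).mkQ y) = (leftRel s t).mkQ (X * y) := rfl

-- Since the relations form a right ideal, the action depends only on the class in `A ⊗_L A`.
-- Relations between operators may therefore be proved modulo the balancing relations.
variable {s t} in
theorem idealizerAct_congr {X Y : idealizer s t}
    (h : (leftRel s t).mkQ X = (leftRel s t).mkQ (Y : A ⊗[k] A)) :
    idealizerAct s t X = idealizerAct s t Y := by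
  ext : 1
  exact LinearMap.ext fun y => mkQ_mul_right s t h y

variable {s t} in
theorem source_tmul_mem_idealizer (h : ∀ l l', s l * t l' = t l' * s l) (l : L) :
    s l ⊗ₜ[k] (1 : A) ∈ idealizer s t :=
  mem_idealizer s t fun l' => by
    simp only [Algebra.TensorProduct.tmul_mul_tmul, mul_one, one_mul, h]
    rw [mkQ_target_mul_tmul, mul_one]

variable {s t} in
theorem tmul_target_mem_idealizer (h : ∀ l l', s l * t l' = t l' * s l) (l : Lᵐᵒᵖ) :
    (1 : A) ⊗ₜ[k] t l ∈ idealizer s t :=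
  mem_idealizer s t fun l' => by
    simp only [Algebra.TensorProduct.tmul_mul_tmul, mul_one, one_mul, ← h]
    rw [← mkQ_target_mul_tmul, mul_one]

end Idealizer

/-! ### The matrix coproduct satisfies the defining relations -/

section Coproduct

/-- The two sides meet in the middle. The exchange relation in the first factor of the left side
produces `t(σ)`, the exchange relation read backwards in the second factor of the right side
produces `s(σ)`, and the tensor sign over `L` identifies the two. -/
theorem exchange_tmul {k A L X : Type*} [CommRing k] [Ring A] [Algebra k A] [Ring L] [Algebra k L]
    [Fintype X] (s : L →ₐ[k] A) (t : Lᵐᵒᵖ →ₐ[k] A) (σ : X → X → X → X → L) (u : X → X → A)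
    (h : ∀ a b c d, ∑ x, ∑ y, s (σ x y a c) * u y d * u x b =
      ∑ x, ∑ y, t (op (σ b d x y)) * u c y * u a x) (a b c d : X) :
    (leftRel s t).mkQ (∑ x, ∑ y, (s (σ x y a c) ⊗ₜ[k] (1 : A)) *
      (∑ z, u y z ⊗ₜ[k] u z d) * (∑ z, u x z ⊗ₜ[k] u z b)) =
    (leftRel s t).mkQ (∑ x, ∑ y, ((1 : A) ⊗ₜ[k] t (op (σ b d x y))) *
      (∑ z, u c z ⊗ₜ[k] u z y) * (∑ z, u a z ⊗ₜ[k] u z x)) := by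
  have h1 : (∑ x, ∑ y, (s (σ x y a c) ⊗ₜ[k] (1 : A)) *
      (∑ z, u y z ⊗ₜ[k] u z d) * (∑ z, u x z ⊗ₜ[k] u z b)) =
      ∑ e, ∑ f, (∑ x, ∑ y, s (σ x y a c) * u y e * u x f) ⊗ₜ[k] (u e d * u f b) := by
    simp only [Finset.mul_sum, Finset.sum_mul, Algebra.TensorProduct.tmul_mul_tmul,
      one_mul, TensorProduct.sum_tmul, ← Fintype.sum_prod_type']
    exact Fintype.sum_equiv ⟨fun i => (i.2.2.2, i.2.2.1, i.1, i.2.1),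
      fun i => (i.2.2.1, i.2.2.2, i.2.1, i.1), fun _ => rfl, fun _ => rfl⟩ _ _ fun i => rfl
  have h2 : (∑ x, ∑ y, ((1 : A) ⊗ₜ[k] t (op (σ b d x y))) *
      (∑ z, u c z ⊗ₜ[k] u z y) * (∑ z, u a z ⊗ₜ[k] u z x)) =
      ∑ e, ∑ f, (u c f * u a e) ⊗ₜ[k] (∑ x, ∑ y, t (op (σ b d x y)) * u f y * u e x) := by
    simp only [Finset.mul_sum, Finset.sum_mul, Algebra.TensorProduct.tmul_mul_tmul,
      one_mul, TensorProduct.tmul_sum, ← Fintype.sum_prod_type']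
    exact Fintype.sum_equiv ⟨fun i => (i.2.2.1, i.2.2.2, i.1, i.2.1),
      fun i => (i.2.2.1, i.2.2.2, i.1, i.2.1), fun _ => rfl, fun _ => rfl⟩ _ _ fun i => rfl
  rw [h1, h2]
  simp_rw [h, ← h _ b _ d]
  simp only [TensorProduct.sum_tmul, TensorProduct.tmul_sum, map_sum, mul_assoc,
    mkQ_target_mul_tmul, ← Fintype.sum_prod_type']
  exact Fintype.sum_equiv ⟨fun i => (i.2.2.1, i.2.2.2, i.2.1, i.1),
      fun i => (i.2.2.2, i.2.2.1, i.1, i.2.1), fun _ => rfl, fun _ => rfl⟩ _ _ fun i => rfl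

variable {k A L X G : Type*} [CommRing k] [Ring A] [Algebra k A] [Ring L] [Algebra k L] [Fintype X]
  [DecidableEq X] {T : G → (L ≃ₐ[k] L)} {deg : X → G} {σ : X → X → X → X → L}

namespace Model

variable (m : Model T deg σ A)

theorem u_mul_src (f : L) (a b : X) : m.u a b * m.src f = m.src (T (deg a) f) * m.u a b :=
  (m.src_u f a b).symm

theorem u_mul_tgt (f : L) (a b : X) :
    m.u a b * m.tgt (op f) = m.tgt (op (T (deg b) f)) * m.u a b :=
  (m.tgt_u f a b).symm

theorem v_mul_src (f : L) (a b : X) :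
    m.v a b * m.src f = m.src ((T (deg b)).symm f) * m.v a b := by
  rw [m.src_v, AlgEquiv.apply_symm_apply]

theorem v_mul_tgt (f : L) (a b : X) :
    m.v a b * m.tgt (op f) = m.tgt (op ((T (deg a)).symm f)) * m.v a b := by
  rw [m.tgt_v, AlgEquiv.apply_symm_apply]

/-- Moving `t(l)` past `u a c` and `s(l)` past `u c b` twists `l` by the same automorphism, that of
the shared index `c`. -/
theorem sum_u_tmul_u_mem (a b : X) :
    ∑ c, m.u a c ⊗ₜ[k] m.u c b ∈ idealizer m.src m.tgt :=
  mem_idealizer _ _ fun l => by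
    simp only [Finset.sum_mul, Algebra.TensorProduct.tmul_mul_tmul, mul_one, map_sum,
      m.u_mul_src, m.u_mul_tgt, mkQ_target_mul_tmul]

theorem sum_v_tmul_v_mem (a b : X) :
    ∑ c, m.v c b ⊗ₜ[k] m.v a c ∈ idealizer m.src m.tgt :=
  mem_idealizer _ _ fun l => by
    simp only [Finset.sum_mul, Algebra.TensorProduct.tmul_mul_tmul, mul_one, map_sum,
      m.v_mul_src, m.v_mul_tgt, mkQ_target_mul_tmul]

theorem tmul_u_v (a b : X) :
    ∑ c, (∑ d, m.u a d ⊗ₜ[k] m.u d c) * (∑ e, m.v e b ⊗ₜ[k] m.v c e) =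
      if a = b then 1 else 0 := by
  calc _ = ∑ d, ∑ e, (m.u a d * m.v e b) ⊗ₜ[k] ∑ c, m.u d c * m.v c e := by
        simp only [Finset.sum_mul_sum, Algebra.TensorProduct.tmul_mul_tmul, TensorProduct.tmul_sum]
        rw [Finset.sum_comm]
        exact Finset.sum_congr rfl fun d _ => Finset.sum_comm
    _ = (∑ d, m.u a d * m.v d b) ⊗ₜ[k] 1 := by
        rw [TensorProduct.sum_tmul]
        simp [m.u_v, TensorProduct.tmul_ite]
    _ = _ := by rw [m.u_v]; split_ifs <;> simp [Algebra.TensorProduct.one_def]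

theorem tmul_v_u (a b : X) :
    ∑ c, (∑ d, m.v d c ⊗ₜ[k] m.v a d) * (∑ e, m.u c e ⊗ₜ[k] m.u e b) =
      if a = b then 1 else 0 := by
  calc _ = ∑ d, ∑ e, (∑ c, m.v d c * m.u c e) ⊗ₜ[k] (m.v a d * m.u e b) := by
        simp only [Finset.sum_mul_sum, Algebra.TensorProduct.tmul_mul_tmul, TensorProduct.sum_tmul]
        rw [Finset.sum_comm]
        exact Finset.sum_congr rfl fun d _ => Finset.sum_comm
    _ = 1 ⊗ₜ[k] (∑ d, m.v a d * m.u d b) := by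
        rw [TensorProduct.tmul_sum]
        simp [m.v_u, TensorProduct.ite_tmul]
    _ = _ := by rw [m.v_u]; split_ifs <;> simp [Algebra.TensorProduct.one_def]

/-- `l ↦ s(l) ⊗ 1` -/
def srcTmul : L →ₐ[k] idealizer m.src m.tgt :=
  (Algebra.TensorProduct.includeLeft.comp m.src).codRestrict _ (source_tmul_mem_idealizer m.comm)

/-- `l ↦ 1 ⊗ t(l)` -/
def tmulTgt : Lᵐᵒᵖ →ₐ[k] idealizer m.src m.tgt :=
  (Algebra.TensorProduct.includeRight.comp m.tgt).codRestrict _ (tmul_target_mem_idealizer m.comm)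

@[simp] theorem coe_srcTmul (l : L) : (m.srcTmul l : A ⊗[k] A) = m.src l ⊗ₜ 1 := rfl

@[simp] theorem coe_tmulTgt (l : Lᵐᵒᵖ) : (m.tmulTgt l : A ⊗[k] A) = 1 ⊗ₜ m.tgt l := rfl

/-- The comultiplication as a model in the endomorphisms of `A ⊗_L A`. -/
def coproduct : Model T deg σ (Module.End k ((A ⊗[k] A) ⧸ leftRel m.src m.tgt)) where
  src := (idealizerAct m.src m.tgt).comp m.srcTmul
  tgt := (idealizerAct m.src m.tgt).comp m.tmulTgt
  u a b := idealizerAct _ _ ⟨_, m.sum_u_tmul_u_mem a b⟩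
  v a b := idealizerAct _ _ ⟨_, m.sum_v_tmul_v_mem a b⟩
  comm l l' := by
    rw [Commute, SemiconjBy]
    simp only [AlgHom.comp_apply, ← map_mul]
    exact idealizerAct_congr (congrArg _ (by simp))
  u_v a b := by
    simp only [← map_mul, ← map_sum]
    rw [← map_one (idealizerAct m.src m.tgt), ← map_zero (idealizerAct m.src m.tgt), ← apply_ite]
    refine idealizerAct_congr (congrArg _ ?_)
    rw [apply_ite Subtype.val]
    simpa using m.tmul_u_v a b
  v_u a b := by
    simp only [← map_mul, ← map_sum]
    rw [← map_one (idealizerAct m.src m.tgt), ← map_zero (idealizerAct m.src m.tgt), ← apply_ite]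
    refine idealizerAct_congr (congrArg _ ?_)
    rw [apply_ite Subtype.val]
    simpa using m.tmul_v_u a b
  src_u f a b := by
    simp only [AlgHom.comp_apply, ← map_mul]
    refine idealizerAct_congr (congrArg _ ?_)
    simp [Finset.mul_sum, Finset.sum_mul, m.src_u]
  tgt_u f a b := by
    simp only [AlgHom.comp_apply, ← map_mul]
    refine idealizerAct_congr (congrArg _ ?_)
    simp [Finset.mul_sum, Finset.sum_mul, m.tgt_u]
  src_v f a b := by
    simp only [AlgHom.comp_apply, ← map_mul]
    refine idealizerAct_congr (congrArg _ ?_)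
    simp [Finset.mul_sum, Finset.sum_mul, m.src_v]
  tgt_v f a b := by
    simp only [AlgHom.comp_apply, ← map_mul]
    refine idealizerAct_congr (congrArg _ ?_)
    simp [Finset.mul_sum, Finset.sum_mul, m.tgt_v]
  exchange a b c d := by
    simp only [AlgHom.comp_apply, ← map_mul, ← map_sum]
    refine idealizerAct_congr ?_
    -- The other relations were verified in `A ⊗ A` itself; this one is an equality of classes in `A
    -- ⊗_L A`.
    have := exchange_tmul m.src m.tgt σ m.u m.exchange a b c d
    simpa only [AddSubmonoidClass.coe_finsetSum, MulMemClass.coe_mul, coe_srcTmul, coe_tmulTgt] using this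

end Model

end Coproduct

/-! ### The left bialgebroid -/

section Bialgebroid

variable {k A L X G : Type*} [CommRing k] [Ring A] [Algebra k A] [Ring L] [Algebra k L] [Fintype X]
  [DecidableEq X] {T : G → (L ≃ₐ[k] L)} {deg : X → G} {σ : X → X → X → X → L}

/-- The matrix elements of `σ` are central and preserve degrees. -/
def WeightZero (T : G → (L ≃ₐ[k] L)) (deg : X → G) (σ : X → X → X → X → L) : Prop :=
  ∀ a b c d f, σ b d a c * T (deg d) (T (deg b) f) = T (deg c) (T (deg a) f) * σ b d a c

/-- The representation of `A_σ` on `L` that gives the counit. -/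
def counitModel (hw : WeightZero T deg σ) : Model T deg σ (Module.End k L) where
  src := Algebra.lmul k L
  tgt := Algebra.lsmul k k L
  u a b := if a = b then (T (deg a)).toLinearMap else 0
  v a b := if a = b then (T (deg a)).symm.toLinearMap else 0
  comm l l' := by
    refine LinearMap.ext fun f => ?_
    simp [mul_assoc]
  u_v a b := by
    rw [Finset.sum_eq_single a (fun c _ hc => by rw [if_neg hc.symm, zero_mul]) (by simp), if_pos rfl]
    split_ifs
    · refine LinearMap.ext fun f => ?_
      simp
    · simp
  v_u a b := by
    rw [Finset.sum_eq_single a (fun c _ hc => by rw [if_neg hc.symm, zero_mul]) (by simp), if_pos rfl]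
    split_ifs
    · refine LinearMap.ext fun f => ?_
      simp
    · simp
  src_u f a b := by
    split_ifs
    · refine LinearMap.ext fun g => ?_
      simp
    · simp
  tgt_u f a b := by
    split_ifs with h
    · subst h
      refine LinearMap.ext fun g => ?_
      simp
    · simp
  src_v f a b := by
    split_ifs with h
    · subst h
      refine LinearMap.ext fun g => ?_
      simp
    · simp
  tgt_v f a b := by
    split_ifs with h
    · refine LinearMap.ext fun g => ?_
      simp
    · simp
  exchange a b c d := by
    -- The operators of `L_{ab}` are diagonal, so one term survives in each double sum, and equality
    -- of the two terms is the weight-zero condition.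
    rw [Finset.sum_eq_single b (fun x _ hx => by simp [hx]) (by simp),
      Finset.sum_eq_single d (fun x _ hx => by simp [hx]) (by simp),
      Finset.sum_eq_single a (fun x _ hx => by simp [hx.symm]) (by simp),
      Finset.sum_eq_single c (fun x _ hx => by simp [hx.symm]) (by simp)]
    refine LinearMap.ext fun f => ?_
    simpa [mul_assoc] using hw a b c d f

/-- A multiplicative map into a quotient of `A ⊗ A` with the values of the comultiplication on the
generators. -/
structure Model.IsComul (m : Model T deg σ A) {P : Submodule k (A ⊗[k] A)}
    (D : A →ₗ[k] (A ⊗[k] A) ⧸ P) : Prop extends IsMultiplicative D where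
  src : ∀ l, D (m.src l) = P.mkQ (m.src l ⊗ₜ 1)
  tgt : ∀ l, D (m.tgt l) = P.mkQ (1 ⊗ₜ m.tgt l)
  u : ∀ a b, D (m.u a b) = P.mkQ (∑ c, m.u a c ⊗ₜ m.u c b)
  v : ∀ a b, D (m.v a b) = P.mkQ (∑ c, m.v c b ⊗ₜ m.v a c)

namespace Model

variable (m : Model T deg σ A)

-- As `D` and `E` have the same values on generators, one representative serves both, and one
-- element of the triple tensor product lifts both `D ⊗ id` and `id ⊗ E`. On `u` and `v` this is the
-- coassociativity of matrix multiplication; sums and products are formal.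
variable {m} in
theorem IsComul.exists_lift (hm : m.Generates) {P Q : Submodule k (A ⊗[k] A)}
    {D : A →ₗ[k] (A ⊗[k] A) ⧸ P} {E : A →ₗ[k] (A ⊗[k] A) ⧸ Q} (hD : m.IsComul D)
    (hE : m.IsComul E) (a : A) :
    ∃ x Z, P.mkQ x = D a ∧ Q.mkQ x = E a ∧ LeftLift D x Z ∧
      RightLift E x (Algebra.TensorProduct.assoc k k k A A A Z) := by
  revert a
  refine hm _ (fun l => ?_) (fun l => ?_) (fun a b => ?_) (fun a b => ?_) ?_ ?_
  · refine ⟨m.src l ⊗ₜ 1, (m.src l ⊗ₜ 1) ⊗ₜ 1, (hD.src l).symm, (hE.src l).symm,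
      hD.leftLift (hD.src l).symm _, ?_⟩
    exact hE.rightLift hE.map_one.symm (m.src l)
  · refine ⟨1 ⊗ₜ m.tgt (op l), (1 ⊗ₜ 1) ⊗ₜ m.tgt (op l), (hD.tgt _).symm, (hE.tgt _).symm,
      hD.leftLift hD.map_one.symm _, ?_⟩
    exact hE.rightLift (hE.tgt (op l)).symm 1
  · refine ⟨∑ c, m.u a c ⊗ₜ m.u c b, ∑ c, (∑ d, m.u a d ⊗ₜ m.u d c) ⊗ₜ m.u c b, (hD.u a b).symm,
      (hE.u a b).symm, LeftLift.sum _ fun c => hD.leftLift (hD.u a c).symm _, ?_⟩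
    have := RightLift.sum Finset.univ fun c => hE.rightLift (hE.u c b).symm (m.u a c)
    convert this using 1
    simp only [TensorProduct.sum_tmul, TensorProduct.tmul_sum, map_sum,
      Algebra.TensorProduct.assoc_tmul]
    exact Finset.sum_comm
  · refine ⟨∑ c, m.v c b ⊗ₜ m.v a c, ∑ c, (∑ d, m.v d b ⊗ₜ m.v c d) ⊗ₜ m.v a c, (hD.v a b).symm,
      (hE.v a b).symm, LeftLift.sum _ fun c => hD.leftLift (hD.v c b).symm _, ?_⟩
    have := RightLift.sum Finset.univ fun c => hE.rightLift (hE.v a c).symm (m.v c b)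
    convert this using 1
    simp only [TensorProduct.sum_tmul, TensorProduct.tmul_sum, map_sum,
      Algebra.TensorProduct.assoc_tmul]
    exact Finset.sum_comm
  · rintro a b ⟨x, Z, h1, h2, h3, h4⟩ ⟨x', Z', h1', h2', h3', h4'⟩
    refine ⟨x + x', Z + Z', by rw [map_add, map_add, h1, h1'], by rw [map_add, map_add, h2, h2'],
      h3.add h3', ?_⟩
    rw [map_add]; exact h4.add h4'
  · rintro a b ⟨x, Z, h1, h2, h3, h4⟩ ⟨x', Z', h1', h2', h3', h4'⟩
    refine ⟨x * x', Z * Z', (hD.map_mul _ _ _ _ h1 h1').symm, (hE.map_mul _ _ _ _ h2 h2').symm,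
      h3.mul h3', ?_⟩
    rw [map_mul]; exact h4.mul h4'

variable {m} in
/-- Coassociativity, for representatives of `E a` on the left-hand side and of `D a` on the
right-hand side. -/
theorem IsComul.coassoc (hm : m.Generates) {ι κ : Type*} {ρ : ι → A →ₗ[k] A} {g : ι → A → A}
    {r : κ → A → A} {γ : κ → A →ₗ[k] A}
    {D : A →ₗ[k] (A ⊗[k] A) ⧸ balanced k r (fun l b => γ l b)}
    {E : A →ₗ[k] (A ⊗[k] A) ⧸ balanced k (fun l a => ρ l a) g}
    (hD : m.IsComul D) (hE : m.IsComul E)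
    (hρ : ∀ l a X, (balanced k r (fun l b => γ l b)).mkQ X = D a →
      D (ρ l a) = (balanced k r (fun l b => γ l b)).mkQ ((ρ l).lTensor A X))
    (hγ : ∀ l b X, (balanced k (fun l a => ρ l a) g).mkQ X = E b →
      E (γ l b) = (balanced k (fun l a => ρ l a) g).mkQ ((γ l).rTensor A X))
    (a : A) {x y : A ⊗[k] A} (hx : (balanced k (fun l a => ρ l a) g).mkQ x = E a)
    (hy : (balanced k r (fun l b => γ l b)).mkQ y = D a) :
    tripleLeft (balanced k r (fun l b => γ l b)) (balanced k (fun l a => ρ l a) g)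
      (D.rTensor A x) =
    tripleRight (balanced k r (fun l b => γ l b)) (balanced k (fun l a => ρ l a) g)
      (E.lTensor A y) := by
  obtain ⟨z, Z, h1, h2, h3, h4⟩ := IsComul.exists_lift hm hD hE a
  have e := tripleLeft_eq_tripleRight hD.map_one hE.map_one h3 h4
  have ex := tripleLeft_balanced ρ g hρ ((Submodule.Quotient.mk_eq_zero _).1
    (show (balanced k (fun l a => ρ l a) g).mkQ (x - z) = 0 by rw [map_sub, hx, h2, sub_self]))
  have ey := tripleRight_balanced r γ hγ ((Submodule.Quotient.mk_eq_zero _).1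
    (show (balanced k r (fun l b => γ l b)).mkQ (y - z) = 0 by rw [map_sub, hy, h1, sub_self]))
  rw [map_sub, map_sub, sub_eq_zero] at ex ey
  rw [ex, ey, e]

/-- The comultiplication. -/
def comul (Δ : A →ₐ[k] Module.End k ((A ⊗[k] A) ⧸ leftRel m.src m.tgt)) :
    A →ₗ[k] (A ⊗[k] A) ⧸ leftRel m.src m.tgt :=
  LinearMap.applyₗ ((leftRel m.src m.tgt).mkQ 1) ∘ₗ Δ.toLinearMap

-- Every operator `Δ a` is the action of some element of the idealizer, so its value at the class of
-- 1 is the class of that element. Multiplicativity then follows from that of `Δ`, with arbitrary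
-- representatives allowed because the relations form a right ideal.
variable {m} in
theorem IsHom.isComul (hm : m.Generates)
    {Δ : A →ₐ[k] Module.End k ((A ⊗[k] A) ⧸ leftRel m.src m.tgt)}
    (hΔ : m.IsHom m.coproduct Δ) : m.IsComul (m.comul Δ) := by
  have hact (a : A) : ∃ Y : idealizer m.src m.tgt, Δ a = idealizerAct m.src m.tgt Y := by
    revert a
    refine hm _ (fun l => ⟨_, hΔ.src l⟩) (fun l => ⟨_, hΔ.tgt _⟩) (fun a b => ⟨_, hΔ.u a b⟩)
      (fun a b => ⟨_, hΔ.v a b⟩) ?_ ?_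
    · rintro a b ⟨Y, hY⟩ ⟨Z, hZ⟩
      exact ⟨Y + Z, by rw [map_add, map_add, hY, hZ]⟩
    · rintro a b ⟨Y, hY⟩ ⟨Z, hZ⟩
      exact ⟨Y * Z, by rw [map_mul, map_mul, hY, hZ]⟩
  have hval {a : A} {Y : idealizer m.src m.tgt} (h : Δ a = idealizerAct m.src m.tgt Y) :
      m.comul Δ a = (leftRel m.src m.tgt).mkQ Y := by
    change Δ a _ = _
    rw [h, idealizerAct_mkQ, mul_one]
  refine { map_one := ?_, map_mul := ?_, src := fun l => hval (hΔ.src l),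
           tgt := fun l => hval (hΔ.tgt l), u := fun a b => hval (hΔ.u a b),
           v := fun a b => hval (hΔ.v a b) }
  · change Δ 1 _ = _
    rw [map_one]; rfl
  · intro a b x y hx hy
    obtain ⟨Y, hY⟩ := hact a
    change Δ (a * b) _ = _
    rw [map_mul, Module.End.mul_apply, show Δ b _ = _ from hy.symm, hY, idealizerAct_mkQ]
    exact mkQ_mul_right _ _ (((hval hY).symm).trans hx.symm) y

/-- The counit. -/
def counit (π : A →ₐ[k] Module.End k L) : A →ₗ[k] L := LinearMap.applyₗ 1 ∘ₗ π.toLinearMap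

theorem counit_apply (π : A →ₐ[k] Module.End k L) (a : A) : counit π a = π a 1 := rfl

theorem counit_mul (π : A →ₐ[k] Module.End k L) (a b : A) :
    counit π (a * b) = π a (counit π b) := by
  simp [counit_apply]

section Counit

variable {m} {hw : WeightZero T deg σ} {π : A →ₐ[k] Module.End k L}

theorem IsHom.apply_src (hπ : m.IsHom (counitModel hw) π) (l f : L) : π (m.src l) f = l * f := by
  rw [hπ.src]; rfl

theorem IsHom.apply_tgt (hπ : m.IsHom (counitModel hw) π) (l : Lᵐᵒᵖ) (f : L) :
    π (m.tgt l) f = f * l.unop := by rw [hπ.tgt]; rfl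

theorem IsHom.apply_u (hπ : m.IsHom (counitModel hw) π) (a b : X) (f : L) :
    π (m.u a b) f = if a = b then T (deg a) f else 0 := by
  rw [hπ.u]
  change (if a = b then (T (deg a)).toLinearMap else 0 : L →ₗ[k] L) f = _
  split_ifs <;> rfl

theorem IsHom.apply_v (hπ : m.IsHom (counitModel hw) π) (a b : X) (f : L) :
    π (m.v a b) f = if a = b then (T (deg a)).symm f else 0 := by
  rw [hπ.v]
  change (if a = b then (T (deg a)).symm.toLinearMap else 0 : L →ₗ[k] L) f = _
  split_ifs <;> rfl

end Counit

end Model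

end Bialgebroid

/-! ### The Hopf algebroid -/

section Antipode

variable {k A L X G : Type*} [CommRing k] [Ring A] [Algebra k A] [Ring L] [Algebra k L] [Fintype X]
  [DecidableEq X] {T : G → (L ≃ₐ[k] L)} {deg : X → G} {σ : X → X → X → X → L}

namespace Model

/-- The relations that make `L_{ab} ↦ (L⁻¹)_{ab} ↦ L_{ab}` extend to an anti-automorphism. -/
structure IsRigid (m : Model T deg σ A) : Prop where
  u_v : ∀ a b, ∑ c, m.u c b * m.v a c = if a = b then 1 else 0
  v_u : ∀ a b, ∑ c, m.v c b * m.u a c = if a = b then 1 else 0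
  exchange : ∀ a b c d, ∑ x, ∑ y, m.v x b * m.v y d * m.tgt (op (σ x y a c)) =
    ∑ x, ∑ y, m.v a x * m.v c y * m.src (σ b d x y)

variable {m : Model T deg σ A}

theorem op_ite {p : Prop} [Decidable p] :
    op (if p then (1 : A) else 0) = if p then (1 : Aᵐᵒᵖ) else 0 := by
  split_ifs <;> simp

/-- The antipode as a model in the opposite algebra. -/
def IsRigid.antipode (hr : m.IsRigid) : Model T deg σ Aᵐᵒᵖ where
  src := AlgHom.opComm.symm m.tgt
  tgt := AlgHom.op m.src
  u a b := op (m.v a b)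
  v a b := op (m.u a b)
  comm l l' := by
    change op (m.tgt (op l)) * op (m.src l'.unop) = op (m.src l'.unop) * op (m.tgt (op l))
    rw [← op_mul, ← op_mul, (m.comm _ _).eq]
  u_v a b := by simp only [← op_mul, ← Finset.op_sum, hr.u_v, op_ite]
  v_u a b := by simp only [← op_mul, ← Finset.op_sum, hr.v_u, op_ite]
  src_u f a b := by
    change op (m.tgt (op _)) * _ = _ * op (m.tgt (op _))
    rw [← op_mul, ← op_mul, m.tgt_v]
  tgt_u f a b := by
    change op (m.src _) * _ = _ * op (m.src _)
    rw [← op_mul, ← op_mul, unop_op, unop_op, m.src_v]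
  src_v f a b := by
    change op (m.tgt (op _)) * _ = _ * op (m.tgt (op _))
    rw [← op_mul, ← op_mul, m.tgt_u]
  tgt_v f a b := by
    change op (m.src _) * _ = _ * op (m.src _)
    rw [← op_mul, ← op_mul, unop_op, unop_op, m.src_u]
  exchange a b c d := by
    change ∑ x, ∑ y, op (m.tgt (op _)) * _ * _ = ∑ x, ∑ y, op (m.src _) * _ * _
    simp only [← op_mul, ← Finset.op_sum, ← mul_assoc, unop_op]
    rw [hr.exchange]

section Antihom

variable {hr : m.IsRigid} {S : A →ₐ[k] Aᵐᵒᵖ}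

theorem IsHom.antipode_src (hS : m.IsHom hr.antipode S) (l : L) :
    S (m.src l) = op (m.tgt (op l)) := hS.src l

theorem IsHom.antipode_tgt (hS : m.IsHom hr.antipode S) (l : L) :
    S (m.tgt (op l)) = op (m.src l) := hS.tgt _

theorem IsHom.antipode_u (hS : m.IsHom hr.antipode S) (a b : X) :
    S (m.u a b) = op (m.v a b) := hS.u a b

theorem IsHom.antipode_v (hS : m.IsHom hr.antipode S) (a b : X) :
    S (m.v a b) = op (m.u a b) := hS.v a b

/-- On generators the antipode exchanges `src` with `tgt` and `u` with `v`. -/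
theorem IsHom.antipode_antipode (hS : m.IsHom hr.antipode S) (hm : m.Generates) (a : A) :
    (S (S a).unop).unop = a := by
  revert a
  refine hm _ (fun l => ?_) (fun l => ?_) (fun a b => ?_) (fun a b => ?_)
    (fun a b ha hb => ?_) (fun a b ha hb => ?_)
  · rw [hS.antipode_src, unop_op, hS.antipode_tgt, unop_op]
  · rw [hS.antipode_tgt, unop_op, hS.antipode_src, unop_op]
  · rw [hS.antipode_u, unop_op, hS.antipode_v, unop_op]
  · rw [hS.antipode_v, unop_op, hS.antipode_u, unop_op]
  · simp only [map_add, unop_add, ha, hb]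
  · simp only [map_mul, unop_mul, ha, hb]

end Antihom

/-- An involutive anti-homomorphism as an equivalence. -/
def antiequiv (S : A →ₐ[k] Aᵐᵒᵖ) (h : ∀ a, (S (S a).unop).unop = a) : A ≃ₐ[k] Aᵐᵒᵖ :=
  AlgEquiv.ofAlgHom S (AlgHom.opComm S)
    (AlgHom.ext fun a => unop_injective (h a.unop)) (AlgHom.ext fun a => h a)

theorem antiequiv_apply (S : A →ₐ[k] Aᵐᵒᵖ) (h : ∀ a, (S (S a).unop).unop = a) (a : A) :
    antiequiv S h a = S a := rfl

variable {hw : WeightZero T deg σ} {hr : m.IsRigid}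
  {Δ : A →ₐ[k] Module.End k ((A ⊗[k] A) ⧸ leftRel m.src m.tgt)} {π : A →ₐ[k] Module.End k L}
  {S : A →ₐ[k] Aᵐᵒᵖ}

theorem counit_map_one (π : A →ₐ[k] Module.End k L) : counit π 1 = 1 := by
  rw [counit_apply, map_one π, Module.End.one_apply]

/-- The bare counit law is not visibly stable under products, so a stronger one is proved by
induction: with `c` the map `x ↦ s(π(x₁)) x₂`, some representative `x` of Δ(a) satisfies `c (x * y)
= a * c y` for all `y`. At `y = 1` this is the law for `x`, and `c` kills the balancing relations.
-/
theorem counit_left (hm : m.Generates) (hΔ : m.IsHom m.coproduct Δ)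
    (hπ : m.IsHom (counitModel hw) π) (a : A) (x : A ⊗[k] A)
    (hx : (leftRel m.src m.tgt).mkQ x = m.comul Δ a) :
    LinearMap.mul' k A
      (TensorProduct.map (m.src.toLinearMap ∘ₗ counit π) LinearMap.id x) = a := by
  have hΔ := hΔ.isComul hm
  set c : A ⊗[k] A →ₗ[k] A := LinearMap.mul' k A ∘ₗ
    TensorProduct.map (m.src.toLinearMap ∘ₗ counit π) LinearMap.id with hc
  have cmul (p q u v : A) : c (p ⊗ₜ q * u ⊗ₜ v) = m.src (π p (counit π u)) * (q * v) := by
    simp [hc, counit_mul]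
  have c1 (u v : A) : c (u ⊗ₜ v) = m.src (counit π u) * v := rfl
  have key (a : A) : ∃ x, (leftRel m.src m.tgt).mkQ x = m.comul Δ a ∧
      ∀ y, c (x * y) = a * c y := by
    have pure {a : A} {x : A ⊗[k] A} (h : ∀ u v, c (x * u ⊗ₜ v) = a * c (u ⊗ₜ v)) (y : A ⊗[k] A) :
        c (x * y) = a * c y := by
      induction y using TensorProduct.induction_on with
      | zero => simp only [mul_zero, map_zero]
      | tmul u v => exact h u v
      | add y z hy hz => simp only [mul_add, map_add, hy, hz]
    revert a
    refine hm _ (fun l => ⟨_, (hΔ.src l).symm, pure fun u v => ?_⟩)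
      (fun l => ⟨_, (hΔ.tgt _).symm, pure fun u v => ?_⟩)
      (fun a b => ⟨_, (hΔ.u a b).symm, pure fun u v => ?_⟩)
      (fun a b => ⟨_, (hΔ.v a b).symm, pure fun u v => ?_⟩) ?_ ?_
    · rw [cmul, c1, hπ.apply_src, one_mul, map_mul, mul_assoc]
    · rw [cmul, c1, map_one, Module.End.one_apply, ← mul_assoc, (m.comm _ _).eq, mul_assoc]
    · rw [Finset.sum_mul, map_sum, Finset.sum_eq_single a (fun c _ hc => ?_) (by simp)]
      · rw [cmul, c1, hπ.apply_u, if_pos rfl, ← mul_assoc, m.src_u, mul_assoc]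
      · rw [cmul, hπ.apply_u, if_neg hc.symm, map_zero, zero_mul]
    · rw [Finset.sum_mul, map_sum, Finset.sum_eq_single b (fun c _ hc => ?_) (by simp)]
      · rw [cmul, c1, hπ.apply_v, if_pos rfl, ← mul_assoc, m.src_v, AlgEquiv.apply_symm_apply,
          mul_assoc]
      · rw [cmul, hπ.apply_v, if_neg hc, map_zero, zero_mul]
    · rintro a b ⟨x, hx, h⟩ ⟨y, hy, h'⟩
      exact ⟨x + y, by rw [map_add, map_add, hx, hy],
        fun z => by rw [add_mul, map_add, h, h', add_mul]⟩
    · rintro a b ⟨x, hx, h⟩ ⟨y, hy, h'⟩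
      exact ⟨x * y, (hΔ.map_mul _ _ _ _ hx hy).symm,
        fun z => by rw [mul_assoc, h, h', mul_assoc]⟩
  obtain ⟨x', hx', h⟩ := key a
  have hker : leftRel m.src m.tgt ≤ LinearMap.ker c := by
    refine Submodule.span_le.2 ?_
    rintro _ ⟨l, u, v, rfl⟩
    rw [SetLike.mem_coe, LinearMap.mem_ker, map_sub, c1, c1, counit_mul, hπ.apply_tgt, map_mul,
      mul_assoc]
    exact sub_self _
  have h0 := hker ((Submodule.Quotient.mk_eq_zero _).1
    (show (leftRel m.src m.tgt).mkQ (x - x') = 0 by rw [map_sub, hx, hx', sub_self]))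
  rw [LinearMap.mem_ker, map_sub, sub_eq_zero] at h0
  change c x = a
  rw [h0, ← mul_one x', h, Algebra.TensorProduct.one_def, c1, counit_map_one, map_one,
    one_mul, mul_one]

/-- The same induction, with `c` the map `x ↦ t(π(x₂)) x₁`. -/
theorem counit_right (hm : m.Generates) (hΔ : m.IsHom m.coproduct Δ)
    (hπ : m.IsHom (counitModel hw) π) (a : A) (x : A ⊗[k] A)
    (hx : (leftRel m.src m.tgt).mkQ x = m.comul Δ a) :
    LinearMap.mul' k A (TensorProduct.comm k A A (TensorProduct.map LinearMap.id
      (m.tgt.toLinearMap ∘ₗ (opLinearEquiv k).toLinearMap ∘ₗ counit π) x)) = a := by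
  have hΔ := hΔ.isComul hm
  set c : A ⊗[k] A →ₗ[k] A := LinearMap.mul' k A ∘ₗ (TensorProduct.comm k A A).toLinearMap ∘ₗ
    TensorProduct.map LinearMap.id
      (m.tgt.toLinearMap ∘ₗ (opLinearEquiv k).toLinearMap ∘ₗ counit π) with hc
  have cmul (p q u v : A) : c (p ⊗ₜ q * u ⊗ₜ v) = m.tgt (op (π q (counit π v))) * (p * u) := by
    simp [hc, counit_mul]
  have c1 (u v : A) : c (u ⊗ₜ v) = m.tgt (op (counit π v)) * u := rfl
  have key (a : A) : ∃ x, (leftRel m.src m.tgt).mkQ x = m.comul Δ a ∧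
      ∀ y, c (x * y) = a * c y := by
    have pure {a : A} {x : A ⊗[k] A} (h : ∀ u v, c (x * u ⊗ₜ v) = a * c (u ⊗ₜ v)) (y : A ⊗[k] A) :
        c (x * y) = a * c y := by
      induction y using TensorProduct.induction_on with
      | zero => simp only [mul_zero, map_zero]
      | tmul u v => exact h u v
      | add y z hy hz => simp only [mul_add, map_add, hy, hz]
    revert a
    refine hm _ (fun l => ⟨_, (hΔ.src l).symm, pure fun u v => ?_⟩)
      (fun l => ⟨_, (hΔ.tgt _).symm, pure fun u v => ?_⟩)
      (fun a b => ⟨_, (hΔ.u a b).symm, pure fun u v => ?_⟩)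
      (fun a b => ⟨_, (hΔ.v a b).symm, pure fun u v => ?_⟩) ?_ ?_
    · rw [cmul, c1, map_one, Module.End.one_apply, ← mul_assoc, ← (m.comm _ _).eq, mul_assoc]
    · rw [cmul, c1, hπ.apply_tgt, one_mul, unop_op, op_mul, map_mul, mul_assoc]
    · rw [Finset.sum_mul, map_sum, Finset.sum_eq_single b (fun c _ hc => ?_) (by simp)]
      · rw [cmul, c1, hπ.apply_u, if_pos rfl, ← mul_assoc, m.tgt_u, mul_assoc]
      · rw [cmul, hπ.apply_u, if_neg hc, op_zero, map_zero, zero_mul]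
    · rw [Finset.sum_mul, map_sum, Finset.sum_eq_single a (fun c _ hc => ?_) (by simp)]
      · rw [cmul, c1, hπ.apply_v, if_pos rfl, ← mul_assoc, m.tgt_v, AlgEquiv.apply_symm_apply,
          mul_assoc]
      · rw [cmul, hπ.apply_v, if_neg hc.symm, op_zero, map_zero, zero_mul]
    · rintro a b ⟨x, hx, h⟩ ⟨y, hy, h'⟩
      exact ⟨x + y, by rw [map_add, map_add, hx, hy],
        fun z => by rw [add_mul, map_add, h, h', add_mul]⟩
    · rintro a b ⟨x, hx, h⟩ ⟨y, hy, h'⟩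
      exact ⟨x * y, (hΔ.map_mul _ _ _ _ hx hy).symm,
        fun z => by rw [mul_assoc, h, h', mul_assoc]⟩
  obtain ⟨x', hx', h⟩ := key a
  have hker : leftRel m.src m.tgt ≤ LinearMap.ker c := by
    refine Submodule.span_le.2 ?_
    rintro _ ⟨l, u, v, rfl⟩
    rw [SetLike.mem_coe, LinearMap.mem_ker, map_sub, c1, c1, counit_mul, hπ.apply_src, op_mul,
      map_mul, mul_assoc]
    exact sub_self _
  have h0 := hker ((Submodule.Quotient.mk_eq_zero _).1
    (show (leftRel m.src m.tgt).mkQ (x - x') = 0 by rw [map_sub, hx, hx', sub_self]))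
  rw [LinearMap.mem_ker, map_sub, sub_eq_zero] at h0
  change c x = a
  rw [h0, ← mul_one x', h, Algebra.TensorProduct.one_def, c1, counit_map_one, op_one,
    map_one, one_mul, mul_one]

/-- Inserting a variable `l` makes the statement inductive: S(a₁) t(l) a₂ = t(S(a) · l), where S(a)
acts on `L` through `π`. For a product, the inner factor produces a new `t(l')`, which is then
inserted between the outer ones. The case of `(L⁻¹)_{ab}` uses rigidity. -/
theorem antipode_mul (hm : m.Generates) (hΔ : m.IsHom m.coproduct Δ)
    (hπ : m.IsHom (counitModel hw) π) (hS : m.IsHom hr.antipode S) (a : A) (x : A ⊗[k] A)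
    (hx : (leftRel m.src m.tgt).mkQ x = m.comul Δ a) :
    LinearMap.mul' k A (TensorProduct.map
      ((opLinearEquiv k).symm.toLinearMap ∘ₗ S.toLinearMap) LinearMap.id x) =
        m.tgt (op (counit π (S a).unop)) := by
  have hΔ := hΔ.isComul hm
  -- `x ↦ S(x₁) t(l) x₂`
  set c : L → A ⊗[k] A →ₗ[k] A := fun l => LinearMap.mul' k A ∘ₗ TensorProduct.map
    (LinearMap.mulRight k (m.tgt (op l)) ∘ₗ (opLinearEquiv k).symm.toLinearMap ∘ₗ S.toLinearMap)
      LinearMap.id with hc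
  have c1 (l) (u v : A) : c l (u ⊗ₜ v) = (S u).unop * m.tgt (op l) * v := rfl
  have cmul (l) (x : A ⊗[k] A) (u v : A) : c l (x * u ⊗ₜ v) = (S u).unop * c l x * v := by
    induction x using TensorProduct.induction_on with
    | zero => simp only [zero_mul, mul_zero, map_zero]
    | tmul p q =>
      rw [Algebra.TensorProduct.tmul_mul_tmul, c1, c1, map_mul, unop_mul]
      simp only [mul_assoc]
    | add y z hy hz => simp only [add_mul, mul_add, map_add, hy, hz]
  have key (a : A) : ∃ x, (leftRel m.src m.tgt).mkQ x = m.comul Δ a ∧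
      ∀ l, c l x = m.tgt (op (π (S a).unop l)) := by
    revert a
    refine hm _ (fun l => ⟨_, (hΔ.src l).symm, fun l' => ?_⟩)
      (fun l => ⟨_, (hΔ.tgt _).symm, fun l' => ?_⟩)
      (fun a b => ⟨_, (hΔ.u a b).symm, fun l' => ?_⟩)
      (fun a b => ⟨_, (hΔ.v a b).symm, fun l' => ?_⟩) ?_ ?_
    · rw [c1, hS.antipode_src, unop_op, mul_one, ← map_mul, hπ.apply_tgt, unop_op, op_mul]
    · rw [c1, hS.antipode_tgt, unop_op, map_one, unop_one, one_mul, ← map_mul, hπ.apply_src,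
        op_mul]
    · rw [hS.antipode_u, unop_op, hπ.apply_v, map_sum]
      calc ∑ i, c l' (m.u a i ⊗ₜ m.u i b)
          = m.tgt (op ((T (deg a)).symm l')) * ∑ i, m.v a i * m.u i b := by
            rw [Finset.mul_sum]
            refine Finset.sum_congr rfl fun i _ => ?_
            rw [c1, hS.antipode_u, unop_op, m.v_mul_tgt, mul_assoc]
        _ = _ := by rw [m.v_u]; split_ifs <;> simp
    · rw [hS.antipode_v, unop_op, hπ.apply_u, map_sum]
      calc ∑ i, c l' (m.v i b ⊗ₜ m.v a i)
          = m.tgt (op (T (deg b) l')) * ∑ i, m.u i b * m.v a i := by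
            rw [Finset.mul_sum]
            refine Finset.sum_congr rfl fun i _ => ?_
            rw [c1, hS.antipode_v, unop_op, m.u_mul_tgt, mul_assoc]
        _ = _ := by
            rw [hr.u_v]
            split_ifs with h
            · rw [h, mul_one]
            · simp
    · rintro a b ⟨x, hx, h⟩ ⟨y, hy, h'⟩
      exact ⟨x + y, by rw [map_add, map_add, hx, hy], fun l => by
        rw [map_add, h, h', map_add, unop_add, map_add, LinearMap.add_apply, op_add, map_add]⟩
    · rintro a b ⟨x, hx, h⟩ ⟨y, hy, h'⟩
      refine ⟨x * y, (hΔ.map_mul _ _ _ _ hx hy).symm, fun l => ?_⟩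
      rw [map_mul S, unop_mul, map_mul π, Module.End.mul_apply, ← h']
      clear hy h'
      induction y using TensorProduct.induction_on with
      | zero => simp only [mul_zero, map_zero]
      | tmul u v => rw [cmul, h, c1]
      | add y z hy hz => simp only [mul_add, map_add, hy, hz]
  obtain ⟨x', hx', h⟩ := key a
  have hker : leftRel m.src m.tgt ≤ LinearMap.ker (c 1) := by
    refine Submodule.span_le.2 ?_
    rintro _ ⟨l, u, v, rfl⟩
    rw [SetLike.mem_coe, LinearMap.mem_ker, map_sub, c1, c1, map_mul, unop_mul, hS.antipode_tgt,
      op_one, map_one, mul_one, mul_one, unop_op, mul_assoc, sub_self]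
  have h0 := hker ((Submodule.Quotient.mk_eq_zero _).1
    (show (leftRel m.src m.tgt).mkQ (x - x') = 0 by rw [map_sub, hx, hx', sub_self]))
  rw [LinearMap.mem_ker, map_sub, sub_eq_zero, h 1] at h0
  rw [counit_apply, ← h0]
  have hc1 : LinearMap.mul' k A ∘ₗ TensorProduct.map
      ((opLinearEquiv k).symm.toLinearMap ∘ₗ S.toLinearMap) LinearMap.id = c 1 := by
    refine TensorProduct.ext' fun u v => ?_
    rw [c1, op_one, map_one, mul_one]
    rfl
  exact LinearMap.congr_fun hc1 x

end Model

end Antipode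

/-! ### The second comultiplication and the Hopf algebroid axioms -/

section Hopf

variable {k A L X G : Type*} [CommRing k] [Ring A] [Algebra k A] [Ring L] [Algebra k L] [Fintype X]
  [DecidableEq X] {T : G → (L ≃ₐ[k] L)} {deg : X → G} {σ : X → X → X → X → L}

namespace Model

variable {m : Model T deg σ A} {hw : WeightZero T deg σ} {hr : m.IsRigid}
  {Δ : A →ₐ[k] Module.End k ((A ⊗[k] A) ⧸ leftRel m.src m.tgt)} {π : A →ₐ[k] Module.End k L}
  {S : A →ₐ[k] Aᵐᵒᵖ}

section IsComul

variable {P : Submodule k (A ⊗[k] A)} {D : A →ₗ[k] (A ⊗[k] A) ⧸ P}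

/-- This and the next three lemmas supply the compatibilities with the balancing actions that
`IsComul.coassoc` requires. -/
theorem IsComul.src_mul (hD : m.IsComul D) (l : L) (a : A) (x : A ⊗[k] A)
    (hx : P.mkQ x = D a) :
    D (m.src l * a) = P.mkQ ((LinearMap.mulLeft k (m.src l)).rTensor A x) := by
  rw [hD.map_mul _ _ _ _ (hD.src l).symm hx]
  congr 1
  refine LinearMap.congr_fun (f := LinearMap.mulLeft k (m.src l ⊗ₜ[k] (1 : A))) ?_ x
  exact TensorProduct.ext' fun u v => by simp

theorem IsComul.tgt_mul (hD : m.IsComul D) (l : L) (a : A) (x : A ⊗[k] A)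
    (hx : P.mkQ x = D a) :
    D (m.tgt (op l) * a) = P.mkQ ((LinearMap.mulLeft k (m.tgt (op l))).lTensor A x) := by
  rw [hD.map_mul _ _ _ _ (hD.tgt (op l)).symm hx]
  congr 1
  refine LinearMap.congr_fun (f := LinearMap.mulLeft k ((1 : A) ⊗ₜ[k] m.tgt (op l))) ?_ x
  exact TensorProduct.ext' fun u v => by simp

theorem IsComul.mul_src (hD : m.IsComul D) (l : L) (a : A) (x : A ⊗[k] A)
    (hx : P.mkQ x = D a) :
    D (a * m.src l) = P.mkQ ((LinearMap.mulRight k (m.src l)).rTensor A x) := by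
  rw [hD.map_mul _ _ _ _ hx (hD.src l).symm]
  congr 1
  refine LinearMap.congr_fun (f := LinearMap.mulRight k (m.src l ⊗ₜ[k] (1 : A))) ?_ x
  exact TensorProduct.ext' fun u v => by simp

theorem IsComul.mul_tgt (hD : m.IsComul D) (l : L) (a : A) (x : A ⊗[k] A)
    (hx : P.mkQ x = D a) :
    D (a * m.tgt (op l)) = P.mkQ ((LinearMap.mulRight k (m.tgt (op l))).lTensor A x) := by
  rw [hD.map_mul _ _ _ _ hx (hD.tgt (op l)).symm]
  congr 1
  refine LinearMap.congr_fun (f := LinearMap.mulRight k ((1 : A) ⊗ₜ[k] m.tgt (op l))) ?_ x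
  exact TensorProduct.ext' fun u v => by simp

end IsComul

/-- The left bialgebroid of a generating model. -/
def leftBialgebroid (hm : m.Generates) (hΔ : m.IsHom m.coproduct Δ)
    (hπ : m.IsHom (counitModel hw) π) : LeftBialgebroid k A L where
  s := m.src
  t := m.tgt
  s_mul_t := m.comm
  comul := m.comul Δ
  counit := counit π
  comul_bimod l l' a x hx := by
    have hD := hΔ.isComul hm
    rw [hD.map_mul _ _ _ _
      (hD.map_mul _ _ _ _ (hD.src l).symm (hD.tgt (op l')).symm).symm hx]
    simp
  counit_bimod l l' a := by
    rw [counit_mul, map_mul, Module.End.mul_apply, hπ.apply_src, hπ.apply_tgt, unop_op, mul_assoc]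
  coassoc a x hx := IsComul.coassoc hm (ρ := fun l => LinearMap.mulLeft k (m.tgt (op l)))
    (γ := fun l => LinearMap.mulLeft k (m.src l)) (hΔ.isComul hm) (hΔ.isComul hm)
    (hΔ.isComul hm).tgt_mul (hΔ.isComul hm).src_mul a hx hx
  counit_comul := counit_left hm hΔ hπ
  comul_counit := counit_right hm hΔ hπ
  comul_takeuchi l a x hx := by
    rw [← sub_eq_zero, ← map_sub, ← mul_sub]
    exact (Submodule.Quotient.mk_eq_zero _).2 ((hΔ.isComul hm).le_comap hx
      (Submodule.subset_span ⟨l, 1, 1, by simp only [mul_one]⟩))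
  comul_one := (hΔ.isComul hm).map_one
  comul_mul a b x y := (hΔ.isComul hm).map_mul a b x y
  counit_one := counit_map_one π
  counit_mul_s a b := by rw [counit_mul, counit_mul, counit_apply π (m.src _), hπ.apply_src, mul_one]
  counit_mul_t a b := by
    rw [counit_mul, counit_mul, counit_apply π (m.tgt _), hπ.apply_tgt, one_mul, unop_op]

/-- The left bialgebroid of a generating model with its antipode. -/
def antipodeBialgebroid (hm : m.Generates) (hΔ : m.IsHom m.coproduct Δ)
    (hπ : m.IsHom (counitModel hw) π) (hS : m.IsHom hr.antipode S) :
    AntipodeBialgebroid k A L where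
  toLeftBialgebroid := leftBialgebroid hm hΔ hπ
  S := antiequiv S (hS.antipode_antipode hm)
  S_t l := congrArg unop (hS.antipode_tgt l)
  S_mul := antipode_mul hm hΔ hπ hS

theorem flipS_mul (S : A ≃ₐ[k] Aᵐᵒᵖ) (x y : A ⊗[k] A) :
    AntipodeBialgebroid.flipS S (x * y) =
      AntipodeBialgebroid.flipS S y * AntipodeBialgebroid.flipS S x := by
  induction x using TensorProduct.induction_on with
  | zero => simp only [zero_mul, mul_zero, map_zero]
  | add u v hu hv => simp only [add_mul, mul_add, map_add, hu, hv]
  | tmul u v =>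
    induction y using TensorProduct.induction_on with
    | zero => simp only [zero_mul, mul_zero, map_zero]
    | add u v hu hv => simp only [add_mul, mul_add, map_add, hu, hv]
    | tmul p q =>
      simp only [Algebra.TensorProduct.tmul_mul_tmul, AntipodeBialgebroid.flipS_tmul, map_mul,
        unop_mul]

theorem flipS_flipS (h : ∀ a, (S (S a).unop).unop = a) (x : A ⊗[k] A) :
    AntipodeBialgebroid.flipS (antiequiv S h) (AntipodeBialgebroid.flipS (antiequiv S h) x) =
      x := by
  induction x using TensorProduct.induction_on with
  | zero => simp only [map_zero]
  | add u v hu hv => simp only [map_add, hu, hv]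
  | tmul u v => simp only [AntipodeBialgebroid.flipS_tmul, antiequiv_apply, h]

section Hopf

variable (hm : m.Generates) (hΔ : m.IsHom m.coproduct Δ) (hπ : m.IsHom (counitModel hw) π)
  (hS : m.IsHom hr.antipode S)

theorem flipR_flipL (z) : (antipodeBialgebroid hm hΔ hπ hS).flipR
    ((antipodeBialgebroid hm hΔ hπ hS).flipL z) = z := by
  obtain ⟨x, rfl⟩ := Submodule.mkQ_surjective _ z
  exact congrArg (leftRel m.src m.tgt).mkQ (flipS_flipS (hS.antipode_antipode hm) x)

theorem flipL_flipR (z) : (antipodeBialgebroid hm hΔ hπ hS).flipL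
    ((antipodeBialgebroid hm hΔ hπ hS).flipR z) = z := by
  obtain ⟨x, rfl⟩ := Submodule.mkQ_surjective _ z
  exact congrArg (rightRel m.src (antiequiv S (hS.antipode_antipode hm))).mkQ
    (flipS_flipS (hS.antipode_antipode hm) x)

/-- Definitional, because the inverse of `antiequiv S` is built from `S` itself. -/
theorem comul'_apply (a : A) : (antipodeBialgebroid hm hΔ hπ hS).comul' a =
    (antipodeBialgebroid hm hΔ hπ hS).flipL (m.comul Δ (S a).unop) := rfl

theorem comul'_eq_mkQ {a b : A} (h : (S a).unop = b) {x : A ⊗[k] A}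
    (hx : m.comul Δ b = (leftRel m.src m.tgt).mkQ x) :
    (antipodeBialgebroid hm hΔ hπ hS).comul' a =
      (rightRel m.src (antiequiv S (hS.antipode_antipode hm))).mkQ
        (AntipodeBialgebroid.flipS (antiequiv S (hS.antipode_antipode hm)) x) := by
  rw [comul'_apply, h, hx]; rfl

/-- Conjugating by the antipode exchanges the formulas for `u` and `v`, and those for `src` and
`tgt`; the flip of tensor factors then restores the formulas of Δ. Products are reversed twice. Only
the balancing relations differ from those of Δ. -/
theorem isComul_comul' : m.IsComul (antipodeBialgebroid hm hΔ hπ hS).comul' := by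
  have hD := hΔ.isComul hm
  refine { map_one := ?_, map_mul := ?_, src := fun l => ?_, tgt := fun l => ?_,
           u := fun a b => ?_, v := fun a b => ?_ }
  · refine (comul'_eq_mkQ hm hΔ hπ hS (by rw [map_one, unop_one]) hD.map_one).trans
      (congrArg _ ?_)
    rw [Algebra.TensorProduct.one_def, AntipodeBialgebroid.flipS_tmul, map_one, unop_one]
  · intro a b x y hx hy
    have rep {a : A} {x : A ⊗[k] A}
        (hx : (rightRel m.src (antiequiv S (hS.antipode_antipode hm))).mkQ x =
          (antipodeBialgebroid hm hΔ hπ hS).comul' a) :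
        (leftRel m.src m.tgt).mkQ
          (AntipodeBialgebroid.flipS (antiequiv S (hS.antipode_antipode hm)) x) =
            m.comul Δ (S a).unop :=
      (congrArg (antipodeBialgebroid hm hΔ hπ hS).flipR hx).trans (flipR_flipL hm hΔ hπ hS _)
    rw [comul'_eq_mkQ hm hΔ hπ hS (by rw [map_mul, unop_mul]) (hD.map_mul _ _ _ _ (rep hy) (rep hx)),
      flipS_mul, flipS_flipS, flipS_flipS]
    rfl
  · refine (comul'_eq_mkQ hm hΔ hπ hS (congrArg unop (hS.antipode_src l)) (hD.tgt _)).trans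
      (congrArg _ ?_)
    rw [AntipodeBialgebroid.flipS_tmul, map_one, unop_one, antiequiv_apply, hS.antipode_tgt,
      unop_op]
  · refine (comul'_eq_mkQ hm hΔ hπ hS (congrArg unop (hS.antipode_tgt l.unop))
      (hD.src _)).trans (congrArg _ ?_)
    rw [AntipodeBialgebroid.flipS_tmul, map_one, unop_one, antiequiv_apply, hS.antipode_src,
      unop_op, op_unop]
  · refine (comul'_eq_mkQ hm hΔ hπ hS (congrArg unop (hS.antipode_u a b)) (hD.v a b)).trans
      (congrArg _ ?_)
    rw [map_sum]
    simp only [AntipodeBialgebroid.flipS_tmul, antiequiv_apply, hS.antipode_v, unop_op]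
  · refine (comul'_eq_mkQ hm hΔ hπ hS (congrArg unop (hS.antipode_v a b)) (hD.u a b)).trans
      (congrArg _ ?_)
    rw [map_sum]
    simp only [AntipodeBialgebroid.flipS_tmul, antiequiv_apply, hS.antipode_u, unop_op]

/-- The Hopf algebroid of a generating rigid model. -/
def hopfAlgebroid : HopfAlgebroid k A L where
  toAntipodeBialgebroid := antipodeBialgebroid hm hΔ hπ hS
  coassoc_left a x y hx hy :=
    IsComul.coassoc hm (γ := fun l => LinearMap.mulLeft k (m.src l))
      (ρ := fun l => LinearMap.mulRight k (S (m.src l)).unop)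
      (hΔ.isComul hm) (isComul_comul' hm hΔ hπ hS)
      -- Since S(s(l)) = t(l), the balancing action on the first factor of `A ⊗_{L'} A` is right
      -- multiplication by `t(l)`.
      (fun l => by rw [hS.antipode_src, unop_op]; exact (hΔ.isComul hm).mul_tgt l)
      (isComul_comul' hm hΔ hπ hS).src_mul a hx hy
  coassoc_right a x y hx hy :=
    IsComul.coassoc hm (γ := fun l => LinearMap.mulRight k (m.src l))
      (ρ := fun l => LinearMap.mulLeft k (m.tgt (op l)))
      (isComul_comul' hm hΔ hπ hS) (hΔ.isComul hm)
      (isComul_comul' hm hΔ hπ hS).tgt_mul (hΔ.isComul hm).mul_src a hx hy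
  flipR_bijective := Function.bijective_iff_has_inverse.2
    ⟨_, flipL_flipR hm hΔ hπ hS, flipR_flipL hm hΔ hπ hS⟩
  flipR_comul' a := flipR_flipL hm hΔ hπ hS _

end Hopf

end Model

end Hopf

/-! ### The base algebra of a weak Hopf algebra is separable Frobenius -/

section WeakHopf

variable {k A L : Type*} [CommRing k] [Ring A] [Algebra k A] [Ring L] [Algebra k L]

namespace WeakHopfAlgebra

variable [W : WeakHopfAlgebra k A]

/-- Weak multiplicativity of the counit with middle factor 1. -/
theorem counit_mul_counitTarget (x a : A) :
    Coalgebra.counit (R := k) (x * counitTarget k a) = Coalgebra.counit (R := k) (x * a) := by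
  have h := counit_mul_right (k := k) x 1 a
  rw [mul_one] at h
  rw [h, counitTarget]
  generalize Coalgebra.comul (R := k) (1 : A) = z
  induction z using TensorProduct.induction_on with
  | zero => simp only [map_zero, mul_zero]
  | tmul p q => simp
  | add u v hu hv => simp only [map_add, mul_add, hu, hv]

/-- Apply ε(· b) to the first leg of the two expressions for (id ⊗ Δ)(Δ(1)): contracting the leg of
Δ(1) ⊗ 1 leaves ε_t(b), to the left of Δ(1) in one expression and to the right in the other. -/
theorem counitTarget_tmul_mul_comul_one (b : A) :
    (counitTarget k b ⊗ₜ[k] 1) * Coalgebra.comul (R := k) (1 : A) =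
      Coalgebra.comul (R := k) (1 : A) * (counitTarget k b ⊗ₜ[k] 1) := by
  have h := (comul_one_left (k := k) (A := A)).symm.trans comul_one_right
  let Ψ : A ⊗[k] (A ⊗[k] A) →ₗ[k] A ⊗[k] A := (TensorProduct.lid k (A ⊗[k] A)).toLinearMap ∘ₗ
    (Coalgebra.counit (R := k) ∘ₗ LinearMap.mulRight k b).rTensor (A ⊗[k] A)
  have h1 (x z : A ⊗[k] A) : Ψ (TensorProduct.assoc k A A A (x ⊗ₜ[k] 1) * ((1 : A) ⊗ₜ[k] z)) =
      (TensorProduct.lid k A (TensorProduct.map (Coalgebra.counit ∘ₗ LinearMap.mulRight k b)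
        LinearMap.id x) ⊗ₜ[k] 1) * z := by
    induction x using TensorProduct.induction_on with
    | zero => simp only [map_zero, TensorProduct.zero_tmul, zero_mul]
    | tmul p q =>
      have : Ψ (TensorProduct.assoc k A A A ((p ⊗ₜ q) ⊗ₜ[k] 1) * ((1 : A) ⊗ₜ[k] z)) =
        Coalgebra.counit (R := k) (p * b) • ((q ⊗ₜ[k] 1) * z) := by simp [Ψ]
      rw [this, ← smul_mul_assoc, TensorProduct.smul_tmul']
      rfl
    | add u v hu hv => simp only [map_add, TensorProduct.add_tmul, add_mul, hu, hv]
  have h2 (x z : A ⊗[k] A) : Ψ (((1 : A) ⊗ₜ[k] z) * TensorProduct.assoc k A A A (x ⊗ₜ[k] 1)) =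
      z * (TensorProduct.lid k A (TensorProduct.map (Coalgebra.counit ∘ₗ LinearMap.mulRight k b)
        LinearMap.id x) ⊗ₜ[k] 1) := by
    induction x using TensorProduct.induction_on with
    | zero => simp only [map_zero, TensorProduct.zero_tmul, mul_zero]
    | tmul p q =>
      have : Ψ (((1 : A) ⊗ₜ[k] z) * TensorProduct.assoc k A A A ((p ⊗ₜ q) ⊗ₜ[k] 1)) =
        Coalgebra.counit (R := k) (p * b) • (z * (q ⊗ₜ[k] 1)) := by simp [Ψ]
      rw [this, ← mul_smul_comm, TensorProduct.smul_tmul']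
      rfl
    | add u v hu hv => simp only [map_add, TensorProduct.add_tmul, mul_add, hu, hv]
  have h := congrArg Ψ h
  rwa [h1, h2] at h

/-- `ε_t` as a linear map. -/
def counitTargetₗ : A →ₗ[k] A where
  toFun := counitTarget k
  map_add' a b := by
    simp only [counitTarget]
    generalize Coalgebra.comul (R := k) (1 : A) = z
    induction z using TensorProduct.induction_on with
    | zero => simp only [map_zero, add_zero]
    | tmul p q => simp [mul_add, add_smul]
    | add u v hu hv => simp only [map_add, hu, hv]; abel
  map_smul' c a := by
    simp only [counitTarget]
    generalize Coalgebra.comul (R := k) (1 : A) = z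
    induction z using TensorProduct.induction_on with
    | zero => simp only [map_zero, smul_zero]
    | tmul p q => simp [mul_smul]
    | add u v hu hv => simp only [map_add, hu, hv, smul_add]

/-- Apply ε to the middle leg of (id ⊗ Δ)(Δ(1)) = (1 ⊗ Δ(1))(Δ(1) ⊗ 1). The left side collapses by
the counit law, and the right side becomes 1₁ ⊗ ε_t(1₂). -/
theorem lTensor_counitTarget_comul_one :
    (counitTargetₗ (k := k) (A := A)).lTensor A (Coalgebra.comul (R := k) (1 : A)) =
      Coalgebra.comul (R := k) (1 : A) := by
  have h := comul_one_right (k := k) (A := A)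
  let Ψ : A ⊗[k] (A ⊗[k] A) →ₗ[k] A ⊗[k] A := ((TensorProduct.lid k A).toLinearMap ∘ₗ
    (Coalgebra.counit (R := k)).rTensor A).lTensor A
  have h1 (x : A ⊗[k] A) : Ψ ((Coalgebra.comul (R := k)).lTensor A x) = x := by
    induction x using TensorProduct.induction_on with
    | zero => simp only [map_zero]
    | tmul p q => simp [Ψ]
    | add u v hu hv => simp only [map_add, hu, hv]
  have h3 (q : A) (z : A ⊗[k] A) : TensorProduct.lid k A ((Coalgebra.counit (R := k)).rTensor A
      (z * (q ⊗ₜ[k] 1))) = TensorProduct.lid k A (TensorProduct.map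
        (Coalgebra.counit ∘ₗ LinearMap.mulRight k q) LinearMap.id z) := by
    induction z using TensorProduct.induction_on with
    | zero => simp only [map_zero, zero_mul]
    | tmul a b => simp
    | add u v hu hv => simp only [map_add, add_mul, hu, hv]
  have h2 (x : A ⊗[k] A) : Ψ (((1 : A) ⊗ₜ[k] Coalgebra.comul (R := k) (1 : A)) *
      TensorProduct.assoc k A A A (x ⊗ₜ[k] 1)) = counitTargetₗ.lTensor A x := by
    induction x using TensorProduct.induction_on with
    | zero => simp only [map_zero, TensorProduct.zero_tmul, mul_zero]
    | tmul p q =>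
      rw [TensorProduct.assoc_tmul, Algebra.TensorProduct.tmul_mul_tmul, one_mul,
        LinearMap.lTensor_tmul, LinearMap.lTensor_tmul]
      exact congrArg (p ⊗ₜ ·) (h3 q _)
    | add u v hu hv => simp only [map_add, TensorProduct.add_tmul, mul_add, hu, hv]
  have h := congrArg Ψ h
  rw [h1, h2] at h
  exact h.symm

end WeakHopfAlgebra

namespace LeftBialgebroid

variable (B : LeftBialgebroid k A L)

theorem counit_s_mul (l : L) (a : A) : B.counit (B.s l * a) = l * B.counit a := by
  have := B.counit_bimod l 1 a
  rwa [op_one, map_one, mul_one, mul_one] at this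

theorem counit_s (l : L) : B.counit (B.s l) = l := by
  have := B.counit_s_mul l 1
  rwa [mul_one, B.counit_one, mul_one] at this

theorem counit_t (l : L) : B.counit (B.t (op l)) = l := by
  have := B.counit_bimod 1 l 1
  rwa [map_one, one_mul, mul_one, B.counit_one, one_mul, one_mul] at this

-- Here s ∘ π = ε_t. In the first Frobenius identity ε absorbs ε_t, then `s(l)` is moved past the
-- first leg of Δ(1) to give π(ε_t(s(l))) = l. In the second, ε_t is absorbed by the second leg of
-- Δ(1), leaving π(t(l)) = l. Idempotency is the bialgebroid counit law at 1.
open WeakHopfAlgebra in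
theorem IsUnderlying.isFrobeniusSeparable {B : LeftBialgebroid k A L} {W : WeakHopfAlgebra k A}
    (h : B.IsUnderlying W) : IsFrobeniusSeparable k L := by
  set δ := Coalgebra.comul (R := k) (1 : A) with hδ
  refine ⟨Coalgebra.counit ∘ₗ B.s.toLinearMap, TensorProduct.map B.counit B.counit δ,
    fun l => ?_, fun l => ?_, ?_⟩
  · have hs : counitTarget k (B.s l) = B.s l := by rw [← h.s_counit, B.counit_s]
    have h1 (x : A ⊗[k] A) : TensorProduct.lid k L (TensorProduct.map
        ((Coalgebra.counit ∘ₗ B.s.toLinearMap) ∘ₗ LinearMap.mulLeft k l) LinearMap.id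
          (TensorProduct.map B.counit B.counit x)) =
        B.counit (TensorProduct.lid k A ((Coalgebra.counit (R := k)).rTensor A
          ((B.s l ⊗ₜ[k] 1) * x))) := by
      induction x using TensorProduct.induction_on with
      | zero => simp only [map_zero, mul_zero]
      | tmul p q => simp [h.s_counit, counit_mul_counitTarget]
      | add u v hu hv => simp only [map_add, mul_add, hu, hv]
    have h2 (x : A ⊗[k] A) : TensorProduct.lid k A ((Coalgebra.counit (R := k)).rTensor A
          (x * (B.s l ⊗ₜ[k] 1))) = TensorProduct.lid k A (TensorProduct.map
          (Coalgebra.counit ∘ₗ LinearMap.mulRight k (B.s l)) LinearMap.id x) := by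
      induction x using TensorProduct.induction_on with
      | zero => simp only [map_zero, zero_mul]
      | tmul p q => simp
      | add u v hu hv => simp only [map_add, add_mul, hu, hv]
    have h3 := counitTarget_tmul_mul_comul_one (k := k) (B.s l)
    rw [hs] at h3
    rw [h1, h3, h2]
    exact (congrArg B.counit hs).trans (B.counit_s l)
  · have h1 (x : A ⊗[k] A) : TensorProduct.rid k L (TensorProduct.map LinearMap.id
        ((Coalgebra.counit ∘ₗ B.s.toLinearMap) ∘ₗ LinearMap.mulRight k l)
          (TensorProduct.map B.counit B.counit x)) =
        B.counit (TensorProduct.rid k A (TensorProduct.map LinearMap.id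
          (Coalgebra.counit (R := k) ∘ₗ LinearMap.mulRight k (B.s l))
            (counitTargetₗ.lTensor A x))) := by
      induction x using TensorProduct.induction_on with
      | zero => simp only [map_zero]
      | tmul p q => simp [h.s_counit, counitTargetₗ]
      | add u v hu hv => simp only [map_add, hu, hv]
    rw [h1, lTensor_counitTarget_comul_one, ← h.t_eq, B.counit_t]
  · have h1 (x : A ⊗[k] A) : LinearMap.mul' k L (TensorProduct.map B.counit B.counit x) =
        B.counit (LinearMap.mul' k A
          (TensorProduct.map (B.s.toLinearMap ∘ₗ B.counit) LinearMap.id x)) := by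
      induction x using TensorProduct.induction_on with
      | zero => simp only [map_zero]
      | tmul p q => simp [counit_s_mul]
      | add u v hu hv => simp only [map_add, hu, hv]
    rw [h1, B.counit_comul 1 δ (h.comul_eq 1).symm, B.counit_one]

end LeftBialgebroid

/-- A nonempty power of `R` is separable with an idempotent Frobenius system only if `R` is. -/
theorem IsFrobeniusSeparable.of_pi {Q R : Type*} [DecidableEq Q] [Ring R] [Algebra k R] (q : Q)
    (h : IsFrobeniusSeparable k (Q → R)) : IsFrobeniusSeparable k R := by
  obtain ⟨φ, e, h1, h2, h3⟩ := h
  let ι : R →ₗ[k] Q → R := LinearMap.single k (fun _ => R) q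
  let ev : (Q → R) →ₗ[k] R := LinearMap.proj q
  -- Multiplying by an element supported at `q` sees only the coordinate `q`. Hence restricting `φ`
  -- along `ι` is compatible with evaluating both legs of `e` at `q`.
  have hι (r : R) (f : Q → R) : ι (r * f q) = ι r * f := Pi.single_mul_left (α := fun _ => R) (f := f) r
  have hι' (r : R) (f : Q → R) : ι (f q * r) = f * ι r := Pi.single_mul_right (α := fun _ => R) (f := f) r
  refine ⟨φ ∘ₗ ι, TensorProduct.map ev ev e, fun r => ?_, fun r => ?_, ?_⟩
  · have key (x : (Q → R) ⊗[k] (Q → R)) : TensorProduct.lid k R (TensorProduct.map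
        ((φ ∘ₗ ι) ∘ₗ LinearMap.mulLeft k r) LinearMap.id (TensorProduct.map ev ev x)) =
        ev (TensorProduct.lid k _ (TensorProduct.map (φ ∘ₗ LinearMap.mulLeft k (ι r))
          LinearMap.id x)) := by
      induction x using TensorProduct.induction_on with
      | zero => simp only [map_zero]
      | tmul f g => simp [ev, hι]
      | add u v hu hv => simp only [map_add, hu, hv]
    rw [key, h1]
    exact Pi.single_eq_same (M := fun _ => R) q r
  · have key (x : (Q → R) ⊗[k] (Q → R)) : TensorProduct.rid k R (TensorProduct.map LinearMap.id
        ((φ ∘ₗ ι) ∘ₗ LinearMap.mulRight k r) (TensorProduct.map ev ev x)) =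
        ev (TensorProduct.rid k _ (TensorProduct.map LinearMap.id
          (φ ∘ₗ LinearMap.mulRight k (ι r)) x)) := by
      induction x using TensorProduct.induction_on with
      | zero => simp only [map_zero]
      | tmul f g => simp [ev, hι']
      | add u v hu hv => simp only [map_add, hu, hv]
    rw [key, h2]
    exact Pi.single_eq_same (M := fun _ => R) q r
  · have key (x : (Q → R) ⊗[k] (Q → R)) : LinearMap.mul' k R (TensorProduct.map ev ev x) =
        ev (LinearMap.mul' k _ x) := by
      induction x using TensorProduct.induction_on with
      | zero => simp only [map_zero]
      | tmul f g => simp [ev]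
      | add u v hu hv => simp only [map_add, hu, hv]
    rw [key, h3]
    rfl

end WeakHopf

set_option linter.unusedSectionVars false

/-! ### Rigidity of the solution given by a quasigroup -/

section QuasigroupModel

variable {Q : Type*} [Quasigroup Q]

theorem mul_ldiv (a c : Q) : a * ldiv a c = c := (Quasigroup.existsUnique_right a c).choose_spec.1

theorem eq_ldiv_iff {a b c : Q} : b = ldiv a c ↔ a * b = c :=
  ⟨fun h => h ▸ mul_ldiv a c,
    fun h => (Quasigroup.existsUnique_right a c).unique h (mul_ldiv a c)⟩

theorem ldiv_mul (a b : Q) : ldiv a (a * b) = b := (eq_ldiv_iff.2 rfl).symm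

theorem qmul_right_cancel {a b c : Q} (h : a * c = b * c) : a = b :=
  (Quasigroup.existsUnique_left c (b * c)).unique h rfl

theorem qmul_left_cancel {a b c : Q} (h : a * b = a * c) : b = c :=
  (Quasigroup.existsUnique_right a (a * c)).unique h rfl

theorem ldiv_right_bijective (a : Q) : Function.Bijective (ldiv a) :=
  Function.bijective_iff_has_inverse.2 ⟨(a * ·), mul_ldiv a, ldiv_mul a⟩

theorem ldiv_left_bijective (c : Q) : Function.Bijective fun a : Q => ldiv a c :=
  (Function.bijective_iff_existsUnique _).2 fun b => by
    simpa only [eq_comm (b := b), eq_ldiv_iff] using Quasigroup.existsUnique_left b c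

variable {M : Type*}

/-- A ternary operation on `M` transported to `Q`. -/
def transport (p : Q ≃ M) (μ : M → M → M → M) (a b c : Q) : Q := p.symm (μ (p a) (p b) (p c))

theorem IsTernary.uniquelySolvable {μ : M → M → M → M} (hμ : IsTernary μ) (p : Q ≃ M) :
    UniquelySolvable (transport p μ) where
  left b c d := by
    simp only [transport, Equiv.symm_apply_eq]
    exact p.existsUnique_congr_right (q := fun z => _ = _) |>.2 (hμ.qg3 (p b) (p c) (p d))
  mid a c d := by
    simp only [transport, Equiv.symm_apply_eq]
    exact p.existsUnique_congr_right (q := fun z => _ = _) |>.2 (hμ.qg4 (p a) (p c) (p d))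
  right a b d := by
    simp only [transport, Equiv.symm_apply_eq]
    exact p.existsUnique_congr_right (q := fun z => _ = _) |>.2 (hμ.qg5 (p a) (p b) (p d))

variable {k R A : Type*} [CommRing k] [Ring R] [Algebra k R] [Ring A] [Algebra k A] [Fintype Q]
  [DecidableEq Q] {p : Q ≃ M} {μ : M → M → M → M}

/-- The condition under which `σ^{ab}_{cd}(x) = 1`. -/
def Flips (p : Q ≃ M) (μ : M → M → M → M) (x a b c d : Q) : Prop :=
  c = ldiv (transport p μ x (x * b) (x * b * a)) (x * b * a) ∧
    d = ldiv x (transport p μ x (x * b) (x * b * a))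

instance (x a b c d : Q) : Decidable (Flips p μ x a b c d) :=
  inferInstanceAs (Decidable (_ ∧ _))

theorem qσ_apply (a b c d x : Q) :
    qσ R p μ a b c d x = if Flips p μ x a b c d then 1 else 0 := rfl

/-- In terms of paths: σ replaces the middle vertex `x * b` of the path from `x` to `x * b * a` by
its image under the ternary operation, keeping both ends, and `d`, `c` are the labels of the new
edges. -/
theorem flips_iff {x a b c d : Q} : Flips p μ x a b c d ↔
    transport p μ x (x * b) (x * b * a) = x * d ∧ x * d * c = x * b * a := by
  rw [Flips, eq_ldiv_iff, eq_ldiv_iff]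
  constructor
  · rintro ⟨h1, h2⟩
    exact ⟨h2.symm, by rw [h2, h1]⟩
  · rintro ⟨h1, h2⟩
    exact ⟨by rw [h1, h2], h1.symm⟩

theorem weightZero_qσ : WeightZero (qT k Q R) qdeg (qσ R p μ) := by
  intro a b c d f
  funext x
  change qσ R p μ b d a c x * f (x * d * b) = f (x * c * a) * qσ R p μ b d a c x
  rw [qσ_apply]
  split_ifs with h
  · rw [(flips_iff.1 h).2, one_mul, mul_one]
  · rw [zero_mul, mul_zero]

theorem qT_single (a l : Q) :
    qT k Q R (qdeg a) (Pi.single (l * a) 1) = Pi.single l 1 := by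
  funext x
  change (Pi.single (l * a) 1 : Q → R) (x * a) = _
  by_cases h : x = l
  · rw [h, Pi.single_eq_same, Pi.single_eq_same]
  · rw [Pi.single_eq_of_ne h, Pi.single_eq_of_ne fun h' => h (qmul_right_cancel h')]

theorem single_mul_ite (C : Q → Prop) [DecidablePred C] (l : Q) :
    (Pi.single l 1 : Q → R) * (fun x => if C x then 1 else 0) =
      if C l then Pi.single l 1 else 0 := by
  rw [← Pi.single_mul_left, one_mul]
  split_ifs <;> simp

theorem ite_mul_single (C : Q → Prop) [DecidablePred C] (l : Q) :
    (fun x => if C x then 1 else 0) * (Pi.single l 1 : Q → R) =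
      if C l then Pi.single l 1 else 0 := by
  rw [← Pi.single_mul_right, mul_one]
  split_ifs <;> simp

namespace Model

variable (m : Model (qT k Q R) qdeg (qσ R p μ) A)

/-- The idempotent of a pair of vertices. -/
def vertex (l n : Q) : A := m.src (Pi.single l 1) * m.tgt (op (Pi.single n 1))

theorem vertex_mul_src_ite (C : Q → Prop) [DecidablePred C] (l n : Q) :
    m.vertex l n * m.src (fun x => if C x then 1 else 0) = if C l then m.vertex l n else 0 := by
  rw [vertex, mul_assoc, ← (m.comm _ _).eq, ← mul_assoc, ← map_mul, single_mul_ite]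
  split_ifs <;> simp

theorem vertex_mul_tgt_ite (C : Q → Prop) [DecidablePred C] (l n : Q) :
    m.vertex l n * m.tgt (op (fun x => if C x then 1 else 0)) =
      if C n then m.vertex l n else 0 := by
  rw [vertex, mul_assoc, ← map_mul, ← op_mul, ite_mul_single]
  split_ifs <;> simp

theorem vertex_mul_src_σ (a b c d l n : Q) :
    m.vertex l n * m.src (qσ R p μ a b c d) =
      if Flips p μ l a b c d then m.vertex l n else 0 :=
  m.vertex_mul_src_ite (fun x => Flips p μ x a b c d) l n

theorem vertex_mul_tgt_σ (a b c d l n : Q) :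
    m.vertex l n * m.tgt (op (qσ R p μ a b c d)) =
      if Flips p μ n a b c d then m.vertex l n else 0 :=
  m.vertex_mul_tgt_ite (fun x => Flips p μ x a b c d) l n

theorem vertex_mul_self (l n : Q) : m.vertex l n * m.vertex l n = m.vertex l n := by
  rw [vertex, mul_assoc, ← mul_assoc (m.tgt _), ← (m.comm _ _).eq, mul_assoc, ← map_mul, ← op_mul,
    ← mul_assoc, ← map_mul]
  simp only [← Pi.single_mul, mul_one]

theorem sum_vertex : ∑ l, ∑ n, m.vertex l n = 1 := by
  have h : ∑ l : Q, (Pi.single l 1 : Q → R) = 1 := by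
    simpa using Finset.univ_sum_single (1 : Q → R)
  simp only [vertex, ← Finset.mul_sum, ← map_sum, ← Finset.op_sum, h, op_one,
    map_one, mul_one]

/-- `L_{ab}` carries the pair of vertices `(l, n)` to `(l * a, n * b)`, which is what makes its cut
pieces faces. -/
theorem vertex_mul_u (l n a b : Q) :
    m.vertex l n * m.u a b = m.u a b * m.vertex (l * a) (n * b) := by
  rw [vertex, vertex, mul_assoc, ← qT_single (k := k) b n, m.tgt_u, ← mul_assoc,
    ← qT_single (k := k) a l, m.src_u, mul_assoc]

theorem vertex_mul_v (l n a b : Q) :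
    m.vertex (l * b) (n * a) * m.v a b = m.v a b * m.vertex l n := by
  rw [vertex, vertex, mul_assoc, m.tgt_v, ← mul_assoc, m.src_v, mul_assoc, qT_single, qT_single]

theorem ext_vertex {a b : A} (h : ∀ l n, m.vertex l n * a = m.vertex l n * b) : a = b := by
  rw [← one_mul a, ← one_mul b, ← m.sum_vertex]
  simp only [Finset.sum_mul, h]

/-- The faces of a model. -/
def faces : FaceSystem Q A where
  e := m.vertex
  u l l' n n' := m.vertex l n * m.u (ldiv l l') (ldiv n n')
  v l l' n n' := m.vertex l' n' * m.v (ldiv n n') (ldiv l l')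
  e_u l l' n n' := by rw [← mul_assoc, vertex_mul_self]
  u_e l l' n n' := by
    conv_lhs => rw [← mul_ldiv l l', ← mul_ldiv n n', ldiv_mul, ldiv_mul]
    rw [mul_assoc, ← vertex_mul_u, ← mul_assoc, vertex_mul_self]
  e_v l l' n n' := by rw [← mul_assoc, vertex_mul_self]
  v_e l l' n n' := by
    rw [mul_assoc, ← vertex_mul_v, mul_ldiv, mul_ldiv, ← mul_assoc, vertex_mul_self]
  u_v l₁ l₂ l' n := by
    have h (n' : Q) : m.vertex l₁ n * m.u (ldiv l₁ l') (ldiv n n') *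
        (m.vertex l' n' * m.v (ldiv n n') (ldiv l₂ l')) =
          m.vertex l₁ n * (m.u (ldiv l₁ l') (ldiv n n') * m.v (ldiv n n') (ldiv l₂ l')) := by
      have := m.vertex_mul_u l₁ n (ldiv l₁ l') (ldiv n n')
      rw [mul_ldiv, mul_ldiv] at this
      rw [← mul_assoc, mul_assoc _ _ (m.vertex l' n'), ← this, ← mul_assoc, vertex_mul_self,
        mul_assoc]
    simp only [h, ← Finset.mul_sum]
    -- Summing over the vertex `n'` amounts to summing over the edge label `ldiv n n'`.
    rw [(ldiv_right_bijective n).sum_comp fun c => m.u (ldiv l₁ l') c * m.v c (ldiv l₂ l'), m.u_v]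
    have : ldiv l₁ l' = ldiv l₂ l' ↔ l₁ = l₂ := (ldiv_left_bijective l').injective.eq_iff
    simp only [this, mul_ite, mul_one, mul_zero]
  v_u l' n n₁ n₂ := by
    have h (l : Q) : m.vertex l' n₁ * m.v (ldiv n n₁) (ldiv l l') *
        (m.vertex l n * m.u (ldiv l l') (ldiv n n₂)) =
          m.vertex l' n₁ * (m.v (ldiv n n₁) (ldiv l l') * m.u (ldiv l l') (ldiv n n₂)) := by
      have := m.vertex_mul_v l n (ldiv n n₁) (ldiv l l')
      rw [mul_ldiv, mul_ldiv] at this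
      rw [← mul_assoc, mul_assoc _ _ (m.vertex l n), ← this, ← mul_assoc, vertex_mul_self,
        mul_assoc]
    simp only [h, ← Finset.mul_sum]
    rw [(ldiv_left_bijective l').sum_comp fun c => m.v (ldiv n n₁) c * m.u c (ldiv n n₂), m.v_u]
    have : ldiv n n₁ = ldiv n n₂ ↔ n₁ = n₂ := (ldiv_right_bijective n).injective.eq_iff
    simp only [this, mul_ite, mul_one, mul_zero]

theorem faces_u (l n a b : Q) : m.faces.u l (l * a) n (n * b) = m.vertex l n * m.u a b := by
  change m.vertex l n * m.u (ldiv l (l * a)) (ldiv n (n * b)) = _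
  rw [ldiv_mul, ldiv_mul]

theorem faces_v (l n a b : Q) :
    m.faces.v l (l * b) n (n * a) = m.vertex (l * b) (n * a) * m.v a b := by
  change m.vertex _ _ * m.v (ldiv n (n * a)) (ldiv l (l * b)) = _
  rw [ldiv_mul, ldiv_mul]

theorem faces_u_mul_u (l n a b c d : Q) :
    m.faces.u l (l * a) n (n * b) * m.faces.u (l * a) (l * a * c) (n * b) (n * b * d) =
      m.vertex l n * (m.u a b * m.u c d) := by
  rw [faces_u, faces_u, ← mul_assoc, mul_assoc _ _ (m.vertex _ _), ← vertex_mul_u, ← mul_assoc,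
    vertex_mul_self, mul_assoc]

theorem faces_v_mul_v (l n a b c d : Q) :
    m.faces.v (l * d) (l * d * b) (n * c) (n * c * a) * m.faces.v l (l * d) n (n * c) =
      m.vertex (l * d * b) (n * c * a) * (m.v a b * m.v c d) := by
  rw [faces_v, faces_v, ← mul_assoc, mul_assoc _ _ (m.vertex _ _), ← vertex_mul_v, ← mul_assoc,
    vertex_mul_self, mul_assoc]

end Model

end QuasigroupModel

/-! ### From unique solvability of μ to rigidity -/

section QuasigroupRigid

variable {Q M : Type*} [Quasigroup Q] {k R A : Type*} [CommRing k] [Ring R] [Algebra k R] [Ring A]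
  [Algebra k A] [Fintype Q] [DecidableEq Q] {p : Q ≃ M} {μ : M → M → M → M}

theorem sum_sum_ite_eq {C : Q → Q → Prop} [∀ x y, Decidable (C x y)] {x₀ y₀ : Q}
    (h : ∀ x y, C x y ↔ x = x₀ ∧ y = y₀) (f : Q → Q → A) :
    ∑ x, ∑ y, (if C x y then f x y else 0) = f x₀ y₀ := by
  simp [h, ite_and]

namespace Model

variable (m : Model (qT k Q R) qdeg (qσ R p μ) A)

/-- Cutting the defining exchange relation with the idempotent of `(l, n)` evaluates σ at `l` on one
side and at `n` on the other. One path survives on each side: on the left by unique solvability in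
the middle variable, on the right because σ determines the new labels. -/
theorem faces_exchange (hμ : UniquelySolvable (transport p μ)) :
    m.faces.Exchange (transport p μ) := by
  intro l l₁ l₂ n n₁ n₂
  obtain ⟨y₀, rfl, -⟩ := Quasigroup.existsUnique_right l l₁
  obtain ⟨x₀, rfl, -⟩ := Quasigroup.existsUnique_right (l * y₀) l₂
  obtain ⟨d, rfl, -⟩ := Quasigroup.existsUnique_right n n₁
  obtain ⟨b, rfl, -⟩ := Quasigroup.existsUnique_right (n * d) n₂
  obtain ⟨c, hc, -⟩ :=
    Quasigroup.existsUnique_right l (transport p μ l (l * y₀) (l * y₀ * x₀))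
  obtain ⟨a, ha, -⟩ := Quasigroup.existsUnique_right (l * c) (l * y₀ * x₀)
  obtain ⟨y₁, hy₁, -⟩ :=
    Quasigroup.existsUnique_right n (transport p μ n (n * d) (n * d * b))
  obtain ⟨x₁, hx₁, -⟩ := Quasigroup.existsUnique_right (n * y₁) (n * d * b)
  have key := m.faces_u_mul_u l n c y₁ a x₁
  rw [ha, hx₁, hc, hy₁] at key
  rw [key, faces_u_mul_u]
  have h1 (x y : Q) : Flips p μ l x y a c ↔ x = x₀ ∧ y = y₀ := by
    rw [flips_iff]
    constructor
    · rintro ⟨h1, h2⟩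
      rw [← h2, ha, hc] at h1
      have hy := qmul_left_cancel ((hμ.mid l (l * y₀ * x₀) _).unique h1 rfl)
      subst hy
      exact ⟨qmul_left_cancel (h2.symm.trans ha), rfl⟩
    · rintro ⟨rfl, rfl⟩
      exact ⟨hc.symm, ha⟩
  have h2 (x y : Q) : Flips p μ n b d x y ↔ x = x₁ ∧ y = y₁ := by
    rw [flips_iff]
    constructor
    · rintro ⟨h1, h2⟩
      have hy := qmul_left_cancel (h1.symm.trans hy₁.symm)
      subst hy
      exact ⟨qmul_left_cancel (h2.trans hx₁.symm), rfl⟩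
    · rintro ⟨rfl, rfl⟩
      exact ⟨hy₁.symm, hx₁⟩
  have h := congrArg (m.vertex l n * ·) (m.exchange a b c d)
  simp only [Finset.mul_sum, mul_assoc] at h
  simp only [← mul_assoc (m.vertex l n), vertex_mul_src_σ, vertex_mul_tgt_σ, ite_mul,
    zero_mul] at h
  rw [sum_sum_ite_eq h1, sum_sum_ite_eq h2] at h
  simpa only [mul_assoc] using h

theorem vertex_mul_v_mul_v (l n a b c d : Q) :
    m.vertex (l * d * b) (n * c * a) * (m.v a b * m.v c d) =
      m.v a b * m.v c d * m.vertex l n := by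
  rw [← mul_assoc, vertex_mul_v, mul_assoc, vertex_mul_v, mul_assoc]

theorem exists_mul_mul_eq (a b c : Q) : ∃ x : Q, x * a * b = c := by
  obtain ⟨y, hy, -⟩ := Quasigroup.existsUnique_left b c
  obtain ⟨x, hx, -⟩ := Quasigroup.existsUnique_left a y
  exact ⟨x, by rw [hx, hy]⟩

theorem isRigid (hμ : UniquelySolvable (transport p μ)) : m.IsRigid where
  u_v a b := m.ext_vertex fun l n => by
    obtain ⟨n₂, hn₂, -⟩ := Quasigroup.existsUnique_left a (n * b)
    have h := FaceSystem.sum_u_mul_v hμ (m.faces_exchange hμ) l n n₂ (n * b)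
    rw [← Function.Bijective.sum_comp (Function.bijective_iff_has_inverse.2
      ⟨ldiv l, ldiv_mul l, mul_ldiv l⟩ : Function.Bijective (l * ·))] at h
    have hab : n = n₂ ↔ a = b :=
      ⟨fun h => qmul_left_cancel (a := n) (by rw [← hn₂, h]),
        fun h => qmul_right_cancel (c := a) (by rw [hn₂, h])⟩
    have h' (c : Q) : m.faces.u l (l * c) n (n * b) * m.faces.v l (l * c) n₂ (n * b) =
        m.vertex l n * (m.u c b * m.v a c) := by
      rw [← hn₂, faces_v, hn₂, faces_u, ← mul_assoc, mul_assoc _ _ (m.vertex _ _),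
        ← vertex_mul_u, ← mul_assoc, vertex_mul_self, mul_assoc]
    simp only [h', hab] at h
    rw [Finset.mul_sum, h]
    split_ifs
    · rw [mul_one]; rfl
    · rw [mul_zero]
  v_u a b := m.ext_vertex fun l₁ n' => by
    obtain ⟨l, hl, -⟩ := Quasigroup.existsUnique_left b l₁
    have h := FaceSystem.sum_v_mul_u hμ (m.faces_exchange hμ) l l₁ (l * a) n'
    have hab : l₁ = l * a ↔ a = b :=
      ⟨fun h => qmul_left_cancel (a := l) (by rw [← h, hl]), fun h => by rw [h, hl]⟩
    have h' (n : Q) : m.faces.v l l₁ n n' * m.faces.u l (l * a) n n' =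
        m.vertex l₁ n' * (m.v (ldiv n n') b * m.u a (ldiv n n')) := by
      obtain ⟨c, rfl, -⟩ := Quasigroup.existsUnique_right n n'
      rw [← hl, faces_v, faces_u, ← mul_assoc, mul_assoc _ _ (m.vertex _ _), ← vertex_mul_v,
        ← mul_assoc, vertex_mul_self, mul_assoc, ldiv_mul]
    simp only [h', hab] at h
    rw [(ldiv_left_bijective n').sum_comp fun c => m.vertex l₁ n' * (m.v c b * m.u a c)] at h
    rw [Finset.mul_sum, h]
    split_ifs
    · rw [mul_one]; rfl
    · rw [mul_zero]
  exchange a b c d := m.ext_vertex fun l₂ n₂ => by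
    obtain ⟨l, rfl⟩ := exists_mul_mul_eq d b l₂
    obtain ⟨n, rfl⟩ := exists_mul_mul_eq c a n₂
    obtain ⟨y₀, hy₀, -⟩ :=
      Quasigroup.existsUnique_right l (transport p μ l (l * d) (l * d * b))
    obtain ⟨x₀, hx₀, -⟩ := Quasigroup.existsUnique_right (l * y₀) (l * d * b)
    -- On this side σ runs backwards: `n₁` is the middle vertex that is moved to `n * c`.
    obtain ⟨n₁, hn₁, -⟩ := hμ.mid n (n * c * a) (n * c)
    obtain ⟨y₁, rfl, -⟩ := Quasigroup.existsUnique_right n n₁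
    obtain ⟨x₁, hx₁, -⟩ := Quasigroup.existsUnique_right (n * y₁) (n * c * a)
    have key := FaceSystem.v_mul_v hμ (m.faces_exchange hμ) l (l * d) (l * d * b) n (n * y₁)
      (n * y₁ * x₁)
    have e := m.faces_v_mul_v l n a x₀ c y₀
    rw [hx₀, hy₀] at e
    rw [faces_v_mul_v, hx₁, hn₁, e] at key
    -- σ stands on the right of the two inverse letters, so it is evaluated at the start of the path
    -- with labels `y`, `x` ending at `n * c * a`. That start is `f x y`, and it depends on the
    -- summation indices.
    choose f hf using fun x y : Q => exists_mul_mul_eq y x (n * c * a)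
    choose g hg using fun x y : Q => exists_mul_mul_eq y x (l * d * b)
    have h1 (x y : Q) : m.vertex (l * d * b) (n * c * a) *
        (m.v x b * m.v y d * m.tgt (op (qσ R p μ x y a c))) =
        if Flips p μ (f x y) x y a c then
          m.vertex (l * d * b) (n * c * a) * (m.v x b * m.v y d) else 0 := by
      rw [← hf x y, ← mul_assoc, vertex_mul_v_mul_v, mul_assoc, vertex_mul_tgt_σ]
      split_ifs
      · rfl
      · rw [mul_zero]
    have h2 (x y : Q) : m.vertex (l * d * b) (n * c * a) *
        (m.v a x * m.v c y * m.src (qσ R p μ b d x y)) =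
        if Flips p μ (g x y) b d x y then
          m.vertex (l * d * b) (n * c * a) * (m.v a x * m.v c y) else 0 := by
      rw [← hg x y, ← mul_assoc, vertex_mul_v_mul_v, mul_assoc, vertex_mul_src_σ]
      split_ifs
      · rfl
      · rw [mul_zero]
    have h3 (x y : Q) : Flips p μ (f x y) x y a c ↔ x = x₁ ∧ y = y₁ := by
      have h := hf x y
      generalize f x y = n' at h ⊢
      rw [flips_iff, h]
      constructor
      · rintro ⟨h1, h2⟩
        obtain rfl := qmul_right_cancel (qmul_right_cancel h2)
        obtain rfl := qmul_left_cancel ((hμ.mid n' _ _).unique h1 hn₁)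
        exact ⟨qmul_left_cancel (h.trans hx₁.symm), rfl⟩
      · rintro ⟨rfl, rfl⟩
        obtain rfl := qmul_right_cancel (qmul_right_cancel (h.trans hx₁.symm))
        exact ⟨hn₁, rfl⟩
    have h4 (x y : Q) : Flips p μ (g x y) b d x y ↔ x = x₀ ∧ y = y₀ := by
      have h := hg x y
      generalize g x y = l' at h ⊢
      rw [flips_iff, h]
      constructor
      · rintro ⟨h1, h2⟩
        obtain rfl := qmul_right_cancel (qmul_right_cancel h2)
        obtain rfl := qmul_left_cancel (h1.symm.trans hy₀.symm)
        exact ⟨qmul_left_cancel (h.trans hx₀.symm), rfl⟩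
      · rintro ⟨rfl, rfl⟩
        obtain rfl := qmul_right_cancel (qmul_right_cancel (h.trans hx₀.symm))
        exact ⟨hy₀.symm, rfl⟩
    simp only [Finset.mul_sum, h1, h2]
    rw [sum_sum_ite_eq h3, sum_sum_ite_eq h4, key]

end Model

/-- The Hopf algebroid structure on `A_σ`. -/
def asigmaHopf (hμ : UniquelySolvable (transport p μ)) :
    HopfAlgebroid k (Asigma k (qT k Q R) qdeg (qσ R p μ)) (Q → R) :=
  Model.hopfAlgebroid (hw := weightZero_qσ)
    (standardModel_generates _ _ _) (Model.isHom_lift _) (Model.isHom_lift _)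
    (hr := (standardModel _ _ _).isRigid hμ) (Model.isHom_lift _)

theorem isStandard_asigmaHopf (hμ : UniquelySolvable (transport p μ)) :
    IsStandard (asigmaHopf (k := k) (R := R) hμ) := by
  have hg := standardModel_generates (qT k Q R) qdeg (qσ R p μ)
  have hΔ := ((standardModel (qT k Q R) qdeg (qσ R p μ)).coproduct.isHom_lift).isComul hg
  have hπ := (counitModel (weightZero_qσ (k := k) (R := R) (p := p) (μ := μ))).isHom_lift
  have hS := (((standardModel (qT k Q R) qdeg (qσ R p μ)).isRigid hμ).antipode).isHom_lift
  exact
    { s_eq := fun l => rfl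
      t_eq := fun l => rfl
      comul_ell := hΔ.u
      comul_ellInv := hΔ.v
      counit_ell := fun a b => (hπ.apply_u a b 1).trans (by rw [map_one])
      counit_ellInv := fun a b => (hπ.apply_v a b 1).trans (by rw [map_one])
      S_s := hS.antipode_src
      S_t := hS.antipode_tgt
      S_ell := hS.antipode_u }

end QuasigroupRigid

end

end HopfAlgd

theorem mainTheorem8 {k Q M R : Type*} [CommRing k] [HopfAlgd.Quasigroup Q] [Fintype Q]
    [DecidableEq Q] [Nontrivial Q] [Ring R] [Algebra k R]
    (p : Q ≃ M) (μ : M → M → M → M) (hμ : HopfAlgd.IsTernary μ) :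
    Nonempty ((Q → R) ≃ₐ[k] (Fin (Fintype.card Q) → R)) ∧
    ∃ H : HopfAlgd.HopfAlgebroid k
        (HopfAlgd.Asigma k (HopfAlgd.qT k Q R) HopfAlgd.qdeg (HopfAlgd.qσ R p μ)) (Q → R),
      HopfAlgd.IsStandard H ∧
      (¬ HopfAlgd.IsFrobeniusSeparable k R →
        ¬ HopfAlgd.IsFrobeniusSeparable k (Q → R) ∧ ¬ H.toLeftBialgebroid.IsWeakHopf) := by
  refine ⟨⟨AlgEquiv.piCongrLeft k (fun _ => R) (Fintype.equivFin Q)⟩, ?_⟩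
  refine ⟨HopfAlgd.asigmaHopf (hμ.uniquelySolvable p), HopfAlgd.isStandard_asigmaHopf _, fun hR => ?_⟩
  have hL : ¬ HopfAlgd.IsFrobeniusSeparable k (Q → R) := fun h =>
    hR (h.of_pi (Classical.arbitrary Q))
  exact ⟨hL, fun ⟨_, hW⟩ => hL hW.isFrobeniusSeparable⟩
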